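/- For $n\ge 1$ and $0<r<\frac1{2n}$ let $Q_n=\mathbb R^2/\mathbb Z^2\setminus\bigcup_{i=0}^{n-1}D_i$, where $D_i$ is the disk of radius $r$ centred at $(i/n,0)$ modulo $\mathbb Z^2$, and consider the unit-speed billiard flow in $Q_n$ with elastic reflections, lifted to the plane; there the obstacles are the disks of radius $r$ centred at the points $(i/n,j)$, $i,j\in\mathbb Z$. The group $\pi_1(Q_n)$ is free on $a,b_1,\dots,b_n$. The element $g\in\pi_1(Q_n)$ of an orbit segment is the product, in order of time, of its wall crossings: crossing a wall $\{0\}\times[r,1-r]$ (mod $\mathbb Z^2$) to the right contributes $a$, crossing a wall $[\frac{i-1}n+r,\frac in-r]\times\{0\}$ (mod $\mathbb Z^2$) upwards contributes $b_i$, and the opposite crossings contribute the inverses. Let $|g|$ be the length of the reduced word of $g$. The ends of $\pi_1(Q_n)$ are the infinite reduced words $e=w_0w_1w_2\dots$ in the letters $a^{\pm1},b_i^{\pm1}$, and $g_m\to e$ means that, for each $k$, the reduced word of $g_m$ begins with $w_0\dots w_{k-1}$ for all large $m$. An orbit segment that starts and ends at a collision is called admissible if (i) any two consecutively visited obstacles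 (in the plane) are different, and the convex hull of their union meets no other obstacle; (ii) each visited obstacle other than the first and the last one is disjoint from the convex hull of the union of the obstacles visited immediately before and after it. Let $C=([0,\infty)\times\mathrm{Ends}(\pi_1(Q_n)))/(\{0\}\times\mathrm{Ends}(\pi_1(Q_n)))$, and let $B(0,\rho)\subset C$ be the set of the points $(s,e)$ with $0\le s\le\rho$. The admissible rotation set $AR\subset C$ consists of the points $(s,e)$ for which there is a sequence of admissible orbit segments, each of minimal length among the curves that visit the boundaries of the same obstacles in the same order, with time spans $T_m\to\infty$ and group elements $g_m$ such that $g_m\to e$ and $|g_m|/T_m\to s$; we then say that the speed $s$ is realized by admissible orbits escaping in the direction $e$. **Theorem.** There are absolute constants $K>0$ and $c>0$ (with $c<\frac12$) such that for all $n\ge1$ and all $0<r\le c/n$ $$B\left(0,\tfrac1{\sqrt5}-\tfrac Kn\right)\subset AR .$$ Moreover, for every infinite reduced word $e$ and every speed $s$ with $0\le s\le\frac1{\sqrt5}-\frac Kn$ (including $s=0$), the speed $s$ is realized by admissible orbits escaping in the direction $e$. -/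

import Mathlib

open Filter Topology
open scoped NNReal

/-- The Euclidean plane, the universal covering space of the flat torus `ℝ² / ℤ²`. -/
abbrev Plane : Type := EuclideanSpace ℝ (Fin 2)

/-! ### The billiard table, unfolded to the plane -/

/-- The centre `(i / n, j)` of a lifted scatterer.  The lifts to the plane of the disks centred at
`(i / n, 0)` modulo `ℤ²`, `0 ≤ i < n`, are exactly the disks centred at `(i / n, j)`, `i j : ℤ`. -/
noncomputable def scattererCenter (n : ℕ) (i : ℤ × ℤ) : Plane :=
  !₂[(i.1 : ℝ) / (n : ℝ), (i.2 : ℝ)]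

/-- The lifted scatterer (closed disk) with index `i`. -/
noncomputable def scatterer (n : ℕ) (r : ℝ) (i : ℤ × ℤ) : Set Plane :=
  Metric.closedBall (scattererCenter n i) r

/-- The unit vector pointing from `p` to `q`. -/
noncomputable def direction (p q : Plane) : Plane := ‖q - p‖⁻¹ • (q - p)

/-- A segment of a billiard orbit (unit speed, lifted to the plane) that starts and ends at a
collision: the collisions take place at the points `point 0, …, point legs` with the scatterers
`obstacle 0, …, obstacle legs`, and in between the motion is rectilinear.
Values at indices larger than `legs` are irrelevant. -/
structure BilliardSegment (n : ℕ) (r : ℝ) where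
  legs : ℕ
  obstacle : ℕ → ℤ × ℤ
  point : ℕ → Plane
  /-- the collision points lie on the boundaries of the scatterers -/
  collision : ∀ k ≤ legs, point k ∈ Metric.sphere (scattererCenter n (obstacle k)) r
  /-- consecutive collision points are different -/
  moving : ∀ k < legs, point k ≠ point (k + 1)
  /-- between consecutive collisions the point moves in the interior of the billiard table -/
  free_flight : ∀ k < legs, ∀ z ∈ openSegment ℝ (point k) (point (k + 1)),
    ∀ i : ℤ × ℤ, z ∉ scatterer n r i
  /-- elastic reflection `v⁺ = v⁻ - 2 ⟨v⁻, ν⟩ ν`, `ν` the unit normal of the scatterer -/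
  reflection : ∀ k, k + 1 < legs →
    direction (point (k + 1)) (point (k + 2)) =
      direction (point k) (point (k + 1)) -
        (2 * inner ℝ (direction (point k) (point (k + 1)))
          (direction (scattererCenter n (obstacle (k + 1))) (point (k + 1)))) •
            direction (scattererCenter n (obstacle (k + 1))) (point (k + 1))

/-- The length of the polygonal curve with vertices `p 0, …, p N`. -/
noncomputable def polygonLength (N : ℕ) (p : ℕ → Plane) : ℝ :=
  ∑ k ∈ Finset.range N, dist (p k) (p (k + 1))

namespace BilliardSegment

variable {n : ℕ} {r : ℝ}

/-- The time span of an orbit segment; as the speed is `1`, it is the length. -/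
noncomputable def time (γ : BilliardSegment n r) : ℝ := polygonLength γ.legs γ.point

/-- Admissibility of an orbit segment: consecutively visited obstacles are different and their
convex hull meets no other obstacle; and no obstacle (but the first and the last one) meets the
convex hull of the obstacles visited just before and just after it. -/
structure IsAdmissible (γ : BilliardSegment n r) : Prop where
  ne : ∀ k < γ.legs, γ.obstacle k ≠ γ.obstacle (k + 1)
  hull : ∀ k < γ.legs, ∀ i : ℤ × ℤ, i ≠ γ.obstacle k → i ≠ γ.obstacle (k + 1) →
    Disjoint
      (convexHull ℝ (scatterer n r (γ.obstacle k) ∪ scatterer n r (γ.obstacle (k + 1))))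
      (scatterer n r i)
  turn : ∀ k, k + 1 < γ.legs →
    Disjoint (scatterer n r (γ.obstacle (k + 1)))
      (convexHull ℝ (scatterer n r (γ.obstacle k) ∪ scatterer n r (γ.obstacle (k + 2))))

/-- The orbit segment is the outcome of the variational method: it is shortest among all curves
that visit the boundaries of the same obstacles in the same order (it is enough to compare with
polygonal curves whose vertices are the visited points). -/
def IsShortest (γ : BilliardSegment n r) : Prop :=
  ∀ q : ℕ → Plane,
    (∀ k ≤ γ.legs, q k ∈ Metric.sphere (scattererCenter n (γ.obstacle k)) r) →
      γ.time ≤ polygonLength γ.legs q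

end BilliardSegment

/-! ### Wall crossings and the fundamental group -/

/-- The free generators of the fundamental group of the table: `none` is `a`, and `some i` is
`b_{i+1}`, `0 ≤ i < n`. -/
abbrev Gen (n : ℕ) : Type := Option (Fin n)

/-- The fundamental group of the table, freely generated by `a, b_1, …, b_n`. -/
abbrev TableGroup (n : ℕ) : Type := FreeGroup (Gen n)

/-- `SegmentWord n r p q g`: the straight motion from `p` to `q` crosses the walls according to
`g`.  Crossing a wall `{j} × [l + r, l + 1 - r]` to the right gives `a`, crossing a wall
`[j + i / n + r, j + (i + 1) / n - r] × {l}` upwards gives `b_{i+1}`, and the opposite crossings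
give the inverses; the contributions are multiplied in the order of time.
A point lying on a wall counts as lying to the right of it, resp. above it. -/
inductive SegmentWord (n : ℕ) (r : ℝ) : Plane → Plane → TableGroup n → Prop
  | stay {p q : Plane} (h0 : ⌊p 0⌋ = ⌊q 0⌋) (h1 : ⌊p 1⌋ = ⌊q 1⌋) : SegmentWord n r p q 1
  | right {p q z : Plane} (h0 : ⌊q 0⌋ = ⌊p 0⌋ + 1) (h1 : ⌊q 1⌋ = ⌊p 1⌋)
      (hz : z ∈ segment ℝ p q) (hz0 : z 0 = (⌊q 0⌋ : ℝ))
      (hz1 : z 1 ∈ Set.Icc ((⌊p 1⌋ : ℝ) + r) ((⌊p 1⌋ : ℝ) + 1 - r)) :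
      SegmentWord n r p q (FreeGroup.of none)
  | up {p q z : Plane} (i : Fin n) (h0 : ⌊q 0⌋ = ⌊p 0⌋) (h1 : ⌊q 1⌋ = ⌊p 1⌋ + 1)
      (hz : z ∈ segment ℝ p q) (hz1 : z 1 = (⌊q 1⌋ : ℝ))
      (hz0 : z 0 ∈ Set.Icc ((⌊p 0⌋ : ℝ) + (i : ℝ) / (n : ℝ) + r)
        ((⌊p 0⌋ : ℝ) + ((i : ℝ) + 1) / (n : ℝ) - r)) :
      SegmentWord n r p q (FreeGroup.of (some i))
  | reverse {p q : Plane} {g : TableGroup n} (h : SegmentWord n r p q g) :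
      SegmentWord n r q p g⁻¹
  | concat {p m q : Plane} {g h : TableGroup n} (hm : m ∈ segment ℝ p q)
      (hg : SegmentWord n r p m g) (hh : SegmentWord n r m q h) : SegmentWord n r p q (g * h)

/-- The orbit segment `γ` defines the element `g` of the fundamental group: `g` is the product of
the wall crossings of its successive legs. -/
def BilliardSegment.HasWord {n : ℕ} {r : ℝ} (γ : BilliardSegment n r) (g : TableGroup n) : Prop :=
  ∃ w : ℕ → TableGroup n,
    (∀ k < γ.legs, SegmentWord n r (γ.point k) (γ.point (k + 1)) (w k)) ∧
      g = ((List.range γ.legs).map w).prod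

/-! ### Directions, speeds and the admissible rotation set -/

/-- The ends of the free group: infinite reduced words in the generators and their inverses.
The letter `(x, true)` is the generator `x`, the letter `(x, false)` is its inverse. -/
def Ends (n : ℕ) : Type :=
  {w : ℕ → Gen n × Bool // ∀ k, w (k + 1) ≠ ((w k).1, !(w k).2)}

/-- `g m` converges to the end `e`: for every `k`, eventually the reduced word of `g m` begins with
the first `k` letters of `e`. -/
def ConvergesToEnd {n : ℕ} (g : ℕ → TableGroup n) (e : Ends n) : Prop :=
  ∀ k : ℕ, ∀ᶠ m in atTop, (List.range k).map e.1 <+: (g m).toWord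

/-- The speed `s` is realized in the direction `e` by admissible orbits: there are admissible,
arc-length minimizing orbit segments with time spans `T_m → ∞` whose elements `g_m` of the
fundamental group converge to `e` and satisfy `dist(g_m, 1) / T_m → s`. -/
def AdmissiblyRealized (n : ℕ) (r : ℝ) (s : ℝ≥0) (e : Ends n) : Prop :=
  ∃ (γ : ℕ → BilliardSegment n r) (g : ℕ → TableGroup n),
    (∀ m, (γ m).IsAdmissible) ∧ (∀ m, (γ m).IsShortest) ∧ (∀ m, (γ m).HasWord (g m)) ∧
      Tendsto (fun m => (γ m).time) atTop atTop ∧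
      Tendsto (fun m => ((g m).norm : ℝ) / (γ m).time) atTop (𝓝 (s : ℝ)) ∧
      ConvergesToEnd g e

/-- The identification of all pairs `(0, e)`. -/
def coneSetoid (n : ℕ) : Setoid (ℝ≥0 × Ends n) where
  r x y := x = y ∨ (x.1 = 0 ∧ y.1 = 0)
  iseqv :=
    { refl := fun _ => Or.inl rfl
      symm := by
        rintro x y (h | ⟨h, h'⟩)
        · exact Or.inl h.symm
        · exact Or.inr ⟨h', h⟩
      trans := by
        rintro x y z (rfl | ⟨h, h'⟩) (rfl | ⟨k, k'⟩)
        · exact Or.inl rfl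
        · exact Or.inr ⟨k, k'⟩
        · exact Or.inr ⟨h, h'⟩
        · exact Or.inr ⟨h, k'⟩ }

/-- The infinite cone `([0, ∞) × Ends) / ({0} × Ends)`. -/
def RotationCone (n : ℕ) : Type := Quotient (coneSetoid n)

/-- The point of the cone with speed `s` and direction `e`. -/
def RotationCone.mk {n : ℕ} (s : ℝ≥0) (e : Ends n) : RotationCone n :=
  Quotient.mk (coneSetoid n) (s, e)

/-- The (closed) ball of radius `ρ` about the vertex of the cone: the points with speed at most
`ρ`.  It is empty if `ρ < 0`. -/
def vertexBall (n : ℕ) (ρ : ℝ) : Set (RotationCone n) :=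
  {v | ∃ (s : ℝ≥0) (e : Ends n), (s : ℝ) ≤ ρ ∧ v = RotationCone.mk s e}

/-- The admissible homotopical rotation set. -/
def admissibleRotationSet (n : ℕ) (r : ℝ) : Set (RotationCone n) :=
  {v | ∃ (s : ℝ≥0) (e : Ends n), AdmissiblyRealized n r s e ∧ v = RotationCone.mk s e}

/-!
Everything takes place along sequences of obstacles in successively adjacent rows.  For such a
sequence a shortest polygon that visits the obstacles exists by compactness.  Under the
admissibility conditions it is a billiard orbit: each vertex minimizes the sum of the distances to
its neighbours on a circle that does not meet the segment between the neighbours, so that the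
normal bisects the angle (`exists_normal_eq_bisector`) and the polygon meets the disk only at the
vertex (`notMem_closedBall_of_shortest`).

An `Itinerary` prescribes a gap between adjacent scatterers for each obstacle, and whether the orbit
turns back there or passes through the gap.  In the latter case the obstacle is chosen among the two
ends of the gap in such a way that the orbit is reflected back into the gap: from the right end if
the neighbouring obstacles are on average to the left of it, and from the left end otherwise.  As
all horizontal indices are integers, this choice can be made recursively, knowing the previous
obstacle and only the gap of the next one, and it yields a margin of at least `1 / n` in
`Itinerary.column_of_through`.  This gives admissibility (`through_disjoint_scatterer`), and it
forces the collision point to lie in the gap (`normal_of_through`).  Therefore the walls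
that the orbit crosses are the prescribed ones, possibly just before instead of just after the
collision; these shifts cancel in the product over all legs (`hasWord`).

A reduced word is translated into an itinerary letter by letter (`WordState.next`).  A letter takes
either one leg of horizontal extent at most `1`, or two legs of horizontal extent at most `1 / 2`
each, up to `O(1 / n)`, since the orbit may have to turn back on the opposite side of a tile.  Thus
it takes a length of at most `2 √(1 + 1 / 4) + O(1 / n) = √5 + O(1 / n)` (`exists_letters_eq`), and
all speeds up to `1 / √5 - O(1 / n)` can be attained.  Smaller speeds are produced by bouncing
vertically within the last tile for a suitable time after all letters have been realized
(`exists_shortest_length_near`).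
-/

/-! ### Shortest paths touching a circle -/

theorem Plane.ext {p q : Plane} (h0 : p 0 = q 0) (h1 : p 1 = q 1) : p = q := by
  ext i; fin_cases i <;> assumption

theorem Plane.norm_sq (v : Plane) : ‖v‖ ^ 2 = v 0 ^ 2 + v 1 ^ 2 := by
  rw [EuclideanSpace.real_norm_sq_eq, Fin.sum_univ_two]

theorem Plane.inner_eq (v w : Plane) : inner ℝ v w = v 0 * w 0 + v 1 * w 1 := by
  simp [PiLp.inner_apply, Fin.sum_univ_two, mul_comm]

theorem Plane.dist_eq (p q : Plane) : dist p q = √((p 0 - q 0) ^ 2 + (p 1 - q 1) ^ 2) := by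
  rw [_root_.dist_eq_norm, ← Real.sqrt_sq (norm_nonneg (p - q)), Plane.norm_sq]; simp

theorem Plane.abs_apply_le (v : Plane) (i : Fin 2) : |v i| ≤ ‖v‖ := PiLp.norm_apply_le v i

/-- A shortest path from `A` to `B` that touches a circle at `p`, where `p` is not on the way from
`A` to `B`, does not meet the closed disk before it arrives at `p`: otherwise it could touch the
circle at an earlier point. -/
theorem notMem_closedBall_of_shortest {c A B p : Plane} {r : ℝ}
    (hA : A ∉ Metric.closedBall c r)
    (hmin : ∀ x ∈ Metric.sphere c r, dist A p + dist p B ≤ dist A x + dist x B)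
    (hAB : p ∉ segment ℝ A B) :
    ∀ z ∈ openSegment ℝ A p, z ∉ Metric.closedBall c r := by
  intro z hz hzc
  have hAp : A ≠ p := by
    rintro rfl; exact hAB (left_mem_segment ℝ _ _)
  obtain ⟨x, hx, hxr⟩ : r ∈ (fun y => dist y c) '' segment ℝ A z := by
    apply (convex_segment A z).isPreconnected.intermediate_value (right_mem_segment ℝ A z)
      (left_mem_segment ℝ A z) (by fun_prop)
    exact ⟨hzc, (not_le.mp hA).le⟩
  have hzp : z ≠ p := by
    rintro rfl
    exact hAp (right_mem_openSegment_iff.mp hz)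
  have h1 : Wbtw ℝ A x z := mem_segment_iff_wbtw.mp hx
  have h2 : Wbtw ℝ A z p := mem_segment_iff_wbtw.mp (openSegment_subset_segment ℝ _ _ hz)
  have h3 : Wbtw ℝ A x p := h2.trans_left h1
  have hxp : x ≠ p := h2.trans_left_ne h1 hzp
  have e1 := h3.dist_add_dist
  have e2 := hmin x hxr
  have e3 := dist_triangle x p B
  have h4 : Wbtw ℝ x p B := dist_add_dist_eq_iff.mp (by linarith)
  exact hAB (mem_segment_iff_wbtw.mpr (h3.trans_expand_right h4 hxp))

/-- First variation of the length of a path touching a circle. -/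
theorem first_variation_circle {c A B p : Plane} {r : ℝ} (hp : p ∈ Metric.sphere c r)
    (hmin : ∀ x ∈ Metric.sphere c r, dist A p + dist p B ≤ dist A x + dist x B)
    (hAp : p ≠ A) (hBp : p ≠ B) :
    (direction p A + direction p B) 0 * (p 1 - c 1) =
      (direction p A + direction p B) 1 * (p 0 - c 0) := by
  set a := p 0 - c 0 with ha
  set b := p 1 - c 1 with hb
  let x : ℝ → Plane := fun t =>
    !₂[c 0 + Real.cos t * a - Real.sin t * b, c 1 + Real.cos t * b + Real.sin t * a]
  have hx0 : x 0 = p := by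
    apply Plane.ext <;> simp [x, ha, hb]
  have hxs : ∀ t, x t ∈ Metric.sphere c r := by
    intro t
    rw [mem_sphere_iff_norm] at hp ⊢
    rw [← hp, ← sq_eq_sq₀ (norm_nonneg _) (norm_nonneg _), Plane.norm_sq, Plane.norm_sq]
    simp only [x, PiLp.sub_apply, Matrix.cons_val_zero, Matrix.cons_val_one,
      ← ha, ← hb]
    linear_combination (a ^ 2 + b ^ 2) * Real.sin_sq_add_cos_sq t
  have hder : ∀ D : Plane, p ≠ D →
      HasDerivAt (fun t => dist D (x t)) (‖D - p‖⁻¹ * ((D 0 - p 0) * b - (D 1 - p 1) * a)) 0 := by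
    intro D hD
    have hpos : 0 < ‖D - p‖ := norm_pos_iff.mpr (sub_ne_zero.mpr (Ne.symm hD))
    have e : (fun t => dist D (x t)) = fun t =>
        √((D 0 - (c 0 + Real.cos t * a - Real.sin t * b)) ^ 2 +
          (D 1 - (c 1 + Real.cos t * b + Real.sin t * a)) ^ 2) := by
      ext t; rw [Plane.dist_eq]; simp [x]
    rw [e]
    have hc := Real.hasDerivAt_cos 0
    have hs := Real.hasDerivAt_sin 0
    have d0 : HasDerivAt (fun t => D 0 - (c 0 + Real.cos t * a - Real.sin t * b)) b 0 := by
      have := (((hc.mul_const a).const_add (c 0)).sub (hs.mul_const b)).const_sub (D 0)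
      exact this.congr_deriv (by simp)
    have d1 : HasDerivAt (fun t => D 1 - (c 1 + Real.cos t * b + Real.sin t * a)) (-a) 0 := by
      have := (((hc.mul_const b).const_add (c 1)).add (hs.mul_const a)).const_sub (D 1)
      exact this.congr_deriv (by simp)
    have hv0 : D 0 - (c 0 + Real.cos 0 * a - Real.sin 0 * b) = D 0 - p 0 := by simp [ha]
    have hv1 : D 1 - (c 1 + Real.cos 0 * b + Real.sin 0 * a) = D 1 - p 1 := by simp [hb]
    have hn : (D 0 - p 0) ^ 2 + (D 1 - p 1) ^ 2 = ‖D - p‖ ^ 2 := by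
      rw [Plane.norm_sq]; simp
    have e0 : (D 0 - (c 0 + Real.cos 0 * a - Real.sin 0 * b)) ^ 2 +
        (D 1 - (c 1 + Real.cos 0 * b + Real.sin 0 * a)) ^ 2 = ‖D - p‖ ^ 2 := by
      rw [hv0, hv1, hn]
    have h := ((d0.fun_pow 2).fun_add (d1.fun_pow 2)).sqrt (by rw [e0]; positivity)
    refine h.congr_deriv ?_
    rw [e0, Real.sqrt_sq hpos.le, hv0, hv1]
    push_cast
    field_simp
    ring
  have hd := (hder A hAp).add (hder B hBp)
  have hm : IsLocalMin ((fun t => dist A (x t)) + fun t => dist B (x t)) 0 := by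
    refine Filter.Eventually.of_forall fun t => ?_
    simp only [Pi.add_apply, hx0]
    rw [dist_comm B, dist_comm B]
    exact hmin _ (hxs t)
  have h0 := hm.hasDerivAt_eq_zero hd
  simp only [direction, PiLp.add_apply, PiLp.smul_apply, PiLp.sub_apply, smul_eq_mul]
  linear_combination h0

theorem norm_direction {p q : Plane} (h : p ≠ q) : ‖direction p q‖ = 1 := by
  rw [direction, norm_smul, norm_inv, norm_norm]
  exact inv_mul_cancel₀ (norm_ne_zero_iff.mpr (sub_ne_zero.mpr h.symm))

theorem norm_smul_direction {p q : Plane} (h : p ≠ q) : ‖q - p‖ • direction p q = q - p := by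
  rw [direction, smul_smul, mul_inv_cancel₀ (norm_ne_zero_iff.mpr (sub_ne_zero.mpr h.symm)),
    one_smul]

theorem direction_comm (p q : Plane) : direction q p = -direction p q := by
  rw [direction, direction, norm_sub_rev, ← smul_neg, neg_sub]

/-- At the point where a shortest path from `A` to `B` touches a circle, the outward normal
bisects the angle between the directions to `A` and to `B`. -/
theorem exists_normal_eq_bisector {c A B p : Plane} {r : ℝ} (hr : 0 < r)
    (hp : p ∈ Metric.sphere c r)
    (hA : A ∉ Metric.closedBall c r) (hB : B ∉ Metric.closedBall c r)
    (hmin : ∀ x ∈ Metric.sphere c r, dist A p + dist p B ≤ dist A x + dist x B)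
    (hAB : p ∉ segment ℝ A B) :
    ∃ κ : ℝ, 0 < κ ∧ p - c = κ • (direction p A + direction p B) := by
  have hAp : p ≠ A := by rintro rfl; exact hAB (left_mem_segment ℝ _ _)
  have hBp : p ≠ B := by rintro rfl; exact hAB (right_mem_segment ℝ _ _)
  have hpr : ‖p - c‖ = r := mem_sphere_iff_norm.mp hp
  have hfv := first_variation_circle hp hmin hAp hBp
  set W := direction p A + direction p B with hW
  have hr2 : (p 0 - c 0) ^ 2 + (p 1 - c 1) ^ 2 = r ^ 2 := by
    rw [← hpr, Plane.norm_sq]; simp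
  obtain ⟨l, hl⟩ : ∃ l : ℝ, W = l • (p - c) := by
    refine ⟨(W 0 * (p 0 - c 0) + W 1 * (p 1 - c 1)) / r ^ 2, ?_⟩
    apply Plane.ext <;> simp only [PiLp.smul_apply, PiLp.sub_apply, smul_eq_mul] <;> field_simp <;>
      rw [← hr2]
    · linear_combination (p 1 - c 1) * hfv
    · linear_combination -(p 0 - c 0) * hfv
  have hnA := norm_direction hAp
  have hnB := norm_direction hBp
  have hl0 : l ≠ 0 := by
    rintro rfl
    rw [zero_smul] at hl
    -- opposite directions: `p` would lie between `A` and `B`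
    apply hAB
    have hu : direction p B = -direction p A := (neg_eq_of_add_eq_zero_right (hW ▸ hl)).symm
    have h1 := norm_smul_direction hAp
    have h2 := norm_smul_direction hBp
    have ha : 0 < ‖A - p‖ := norm_pos_iff.mpr (sub_ne_zero.mpr hAp.symm)
    have hb : 0 < ‖B - p‖ := norm_pos_iff.mpr (sub_ne_zero.mpr hBp.symm)
    rw [hu] at h2
    refine ⟨‖B - p‖ / (‖A - p‖ + ‖B - p‖), ‖A - p‖ / (‖A - p‖ + ‖B - p‖), by positivity,
      by positivity, by field_simp; ring, ?_⟩
    have eA : A = p + ‖A - p‖ • direction p A := by rw [h1]; abel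
    have eB : B = p - ‖B - p‖ • direction p A := by
      rw [sub_eq_add_neg, ← smul_neg, h2]; abel
    generalize ‖A - p‖ = α at *
    generalize ‖B - p‖ = β at *
    have hαβ : α + β ≠ 0 := by positivity
    rw [eA, eB]
    apply Plane.ext <;> simp <;> field_simp <;> ring
  have hlpos : 0 < l := by
    by_contra hneg
    have hlneg : l < 0 := lt_of_le_of_ne (not_lt.mp hneg) hl0
    have hin : inner ℝ (direction p A) (p - c) = l * r ^ 2 / 2 := by
      have e : direction p B = l • (p - c) - direction p A := by rw [← hl, hW]; abel
      have h1 : ‖direction p B‖ ^ 2 = 1 := by rw [hnB]; norm_num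
      rw [e, norm_sub_sq_real, hnA, norm_smul, mul_pow, hpr, real_inner_smul_left,
        real_inner_comm] at h1
      simp only [Real.norm_eq_abs, sq_abs] at h1
      have h2 : l * (l * r ^ 2 - 2 * inner ℝ (direction p A) (p - c)) = 0 := by linarith
      rcases mul_eq_zero.mp h2 with h | h
      · exact absurd h hl0
      · linarith
    -- the path would arrive at `p` from inside the disk
    have ha : 0 < ‖A - p‖ := norm_pos_iff.mpr (sub_ne_zero.mpr hAp.symm)
    set τ := min (‖A - p‖ / 2) (-(l * r ^ 2)) with hτ
    have hτ0 : 0 < τ := lt_min (by linarith) (by nlinarith [sq_pos_of_pos hr])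
    have hτ1 : τ ≤ ‖A - p‖ / 2 := min_le_left _ _
    have hτ2 : τ ≤ -(l * r ^ 2) := min_le_right _ _
    have hmem : p + τ • direction p A ∈ openSegment ℝ A p := by
      refine ⟨τ / ‖A - p‖, 1 - τ / ‖A - p‖, by positivity, ?_, by ring, ?_⟩
      · rw [sub_pos, div_lt_one ha]; linarith
      · rw [direction]; apply Plane.ext <;> simp <;> field_simp <;> ring
    apply notMem_closedBall_of_shortest hA hmin hAB _ hmem
    rw [mem_closedBall_iff_norm]
    apply le_of_sq_le_sq _ hr.le
    have e : p + τ • direction p A - c = (p - c) + τ • direction p A := by abel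
    rw [e, norm_add_sq_real, hpr, norm_smul, hnA, real_inner_smul_right, real_inner_comm, hin]
    simp only [Real.norm_eq_abs, mul_one, sq_abs]
    nlinarith
  refine ⟨l⁻¹, inv_pos.mpr hlpos, ?_⟩
  rw [hl, smul_smul, inv_mul_cancel₀ hl0, one_smul]

/-- The law of reflection for an outward normal bisecting the angle of the path. -/
theorem reflection_of_bisector {c A B p : Plane} {r κ : ℝ} (hr : 0 < r)
    (hp : p ∈ Metric.sphere c r) (hAp : A ≠ p) (hBp : p ≠ B)
    (h : p - c = κ • (direction p A + direction p B)) :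
    direction p B = direction A p - (2 * inner ℝ (direction A p) (direction c p)) •
      direction c p := by
  have hpr : ‖p - c‖ = r := mem_sphere_iff_norm.mp hp
  have hnA := norm_direction hAp.symm
  have hnB := norm_direction hBp
  rw [direction_comm p A, show direction c p = r⁻¹ • (p - c) by rw [direction, hpr], h]
  have hsq : κ ^ 2 * (2 + 2 * inner ℝ (direction p A) (direction p B)) = r ^ 2 := by
    rw [← hpr, h, norm_smul, mul_pow, norm_add_sq_real, hnA, hnB]
    simp only [Real.norm_eq_abs, sq_abs]; ring
  simp only [inner_neg_left, real_inner_smul_right, inner_add_right,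
    real_inner_self_eq_norm_sq, hnA]
  set i := inner ℝ (direction p A) (direction p B)
  rw [smul_smul, smul_smul]
  have : 2 * -(r⁻¹ * (κ * (1 ^ 2 + i))) * r⁻¹ * κ = -1 := by
    field_simp; linarith
  rw [this]
  module

/-- A shortest path leaves the circle outwards. -/
theorem inner_normal_nonneg {c A B p : Plane} {κ : ℝ} (hκ : 0 < κ) (hAp : p ≠ A) (hBp : p ≠ B)
    (h : p - c = κ • (direction p A + direction p B)) :
    0 ≤ inner ℝ (A - p) (p - c) := by
  rw [← norm_smul_direction hAp, h, real_inner_smul_left, real_inner_smul_right, inner_add_right,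
    real_inner_self_eq_norm_sq, norm_direction hAp]
  have := abs_real_inner_le_norm (direction p A) (direction p B)
  rw [norm_direction hAp, norm_direction hBp] at this
  have := (abs_le.mp this).1
  have : 0 ≤ 1 ^ 2 + inner ℝ (direction p A) (direction p B) := by linarith
  positivity

/-! ### Convex hulls of pairs of disks -/

theorem abs_linear_le_of_mem_closedBall {c z : Plane} {r : ℝ} (hz : z ∈ Metric.closedBall c r)
    (α β : ℝ) : |α * (z 0 - c 0) + β * (z 1 - c 1)| ≤ r * (|α| + |β|) := by
  rw [mem_closedBall_iff_norm] at hz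
  have h0 : |z 0 - c 0| ≤ r := (Plane.abs_apply_le (z - c) 0).trans hz
  have h1 : |z 1 - c 1| ≤ r := (Plane.abs_apply_le (z - c) 1).trans hz
  calc _ ≤ |α * (z 0 - c 0)| + |β * (z 1 - c 1)| := abs_add_le _ _
    _ = |α| * |z 0 - c 0| + |β| * |z 1 - c 1| := by rw [abs_mul, abs_mul]
    _ ≤ |α| * r + |β| * r := by gcongr
    _ = _ := by ring

/-- A linear functional separating the centre of a disk from those of two other disks by a large
enough margin separates the disk from the convex hull of the two others. -/
theorem disjoint_convexHull_of_linear {c₁ c₂ c : Plane} {r : ℝ} (α β : ℝ)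
    (h₁ : 2 * r * (|α| + |β|) < α * (c 0 - c₁ 0) + β * (c 1 - c₁ 1))
    (h₂ : 2 * r * (|α| + |β|) < α * (c 0 - c₂ 0) + β * (c 1 - c₂ 1)) :
    Disjoint (convexHull ℝ (Metric.closedBall c₁ r ∪ Metric.closedBall c₂ r))
      (Metric.closedBall c r) := by
  set v := α * c 0 + β * c 1 - r * (|α| + |β|) with hv
  have hconv : Convex ℝ {z : Plane | α * z 0 + β * z 1 < v} := by
    apply convex_halfSpace_lt
    constructor
    · intro x y; simp; ring
    · intro t x; simp; ring
  have hsub : convexHull ℝ (Metric.closedBall c₁ r ∪ Metric.closedBall c₂ r) ⊆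
      {z : Plane | α * z 0 + β * z 1 < v} := by
    apply convexHull_min _ hconv
    rintro z (hz | hz)
    · have := (abs_le.mp (abs_linear_le_of_mem_closedBall hz α β)).2
      simp only [Set.mem_ofPred_eq, hv]; linarith
    · have := (abs_le.mp (abs_linear_le_of_mem_closedBall hz α β)).2
      simp only [Set.mem_ofPred_eq, hv]; linarith
  rw [Set.disjoint_left]
  intro z hz hzc
  have h3 := hsub hz
  have := (abs_le.mp (abs_linear_le_of_mem_closedBall hzc α β)).1
  simp only [Set.mem_ofPred_eq, hv] at h3
  linarith

/-! ### Shortest polygons -/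

/-- The vertices of `p` lie on the boundaries of the obstacles `O 0, O 1, …`, and the first `L`
edges of `p` form a shortest polygon visiting `O 0, …, O L` in this order. -/
structure IsShortestPolygon (n : ℕ) (r : ℝ) (O : ℕ → ℤ × ℤ) (L : ℕ) (p : ℕ → Plane) : Prop where
  mem_sphere : ∀ k, p k ∈ Metric.sphere (scattererCenter n (O k)) r
  length_le : ∀ q : ℕ → Plane, (∀ k ≤ L, q k ∈ Metric.sphere (scattererCenter n (O k)) r) →
    polygonLength L p ≤ polygonLength L q

theorem exists_isShortestPolygon (n : ℕ) {r : ℝ} (hr : 0 < r) (O : ℕ → ℤ × ℤ) (L : ℕ) :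
    ∃ p : ℕ → Plane, IsShortestPolygon n r O L p := by
  have hne : ∀ k, (Metric.sphere (scattererCenter n (O k)) r).Nonempty := fun k =>
    NormedSpace.sphere_nonempty.mpr hr.le
  have hK : IsCompact (Set.univ.pi fun k => Metric.sphere (scattererCenter n (O k)) r) :=
    isCompact_univ_pi fun k => isCompact_sphere _ _
  have hKne : (Set.univ.pi fun k => Metric.sphere (scattererCenter n (O k)) r).Nonempty :=
    Set.univ_pi_nonempty_iff.mpr hne
  have hcont : Continuous (polygonLength L) := by
    unfold polygonLength; fun_prop
  obtain ⟨p, hp, hmin⟩ := hK.exists_isMinOn hKne hcont.continuousOn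
  refine ⟨p, fun k => hp k trivial, fun q hq => ?_⟩
  let q' : ℕ → Plane := fun k => if k ≤ L then q k else p k
  have hq' : q' ∈ Set.univ.pi fun k => Metric.sphere (scattererCenter n (O k)) r := by
    intro k _
    by_cases h : k ≤ L
    · simpa [q', h] using hq k h
    · simpa [q', h] using hp k trivial
  have e : polygonLength L q' = polygonLength L q := by
    apply Finset.sum_congr rfl
    intro k hk
    have hk := Finset.mem_range.mp hk
    simp [q', hk.le, Nat.succ_le_of_lt hk]
  exact (hmin hq').trans_eq e

/-- The index of the vertex before the vertex `k` of a polygon; the first vertex is regarded as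
being visited on a way from and back to the second one. -/
def prevIndex (k : ℕ) : ℕ := if k = 0 then 1 else k - 1

/-- The index of the vertex after the vertex `k` of a polygon with `L` edges; the last vertex is
regarded as being visited on a way from and back to the last but one. -/
def nextIndex (L k : ℕ) : ℕ := if k = L then L - 1 else k + 1

theorem polygonLength_update (L k : ℕ) (hk : k ≤ L) (p : ℕ → Plane) (x : Plane) :
    polygonLength L (Function.update p k x) - polygonLength L p =
      (if k = 0 then 0 else dist (p (k - 1)) x - dist (p (k - 1)) (p k)) +
        (if k = L then 0 else dist x (p (k + 1)) - dist (p k) (p (k + 1))) := by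
  have key : ∀ j, dist (Function.update p k x j) (Function.update p k x (j + 1)) -
      dist (p j) (p (j + 1)) = (if j + 1 = k then dist (p (k - 1)) x - dist (p (k - 1)) (p k)
        else 0) + (if j = k then dist x (p (k + 1)) - dist (p k) (p (k + 1)) else 0) := by
    intro j
    rcases eq_or_ne j k with rfl | h
    · simp
    · rcases eq_or_ne (j + 1) k with rfl | h'
      · simp
      · simp [h, h']
  unfold polygonLength
  rw [← Finset.sum_sub_distrib, Finset.sum_congr rfl fun j _ => key j, Finset.sum_add_distrib]
  congr 1
  · rcases Nat.eq_zero_or_pos k with rfl | h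
    · simp
    · obtain ⟨i, rfl⟩ := Nat.exists_eq_add_of_le' h
      simp only [add_left_inj, Finset.sum_ite_eq', Finset.mem_range]
      rw [if_pos (by omega), if_neg (by omega)]
  · rw [Finset.sum_ite_eq']
    by_cases h : k = L
    · simp [h]
    · rw [if_pos (by simp; omega), if_neg h]

/-- Each vertex of a shortest polygon minimizes the sum of the distances to its neighbours. -/
theorem IsShortestPolygon.local_min {n : ℕ} {r : ℝ} {O : ℕ → ℤ × ℤ} {L : ℕ} (hL : 0 < L)
    {p : ℕ → Plane} (hp : IsShortestPolygon n r O L p) {k : ℕ} (hk : k ≤ L) {x : Plane}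
    (hx : x ∈ Metric.sphere (scattererCenter n (O k)) r) :
    dist (p (prevIndex k)) (p k) + dist (p k) (p (nextIndex L k)) ≤
      dist (p (prevIndex k)) x + dist x (p (nextIndex L k)) := by
  have h1 := hp.length_le (Function.update p k x) (by
    intro j _
    rcases eq_or_ne j k with rfl | h
    · simpa using hx
    · simpa [h] using hp.mem_sphere j)
  have h2 := polygonLength_update L k hk p x
  unfold prevIndex nextIndex
  by_cases h0 : k = 0 <;> by_cases hl : k = L
  · omega
  · rw [if_pos h0, if_neg hl] at *
    rw [dist_comm _ x, dist_comm _ (p k)]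
    subst h0
    simp only [zero_add] at h2 ⊢
    linarith
  · rw [if_neg h0, if_pos hl] at *
    subst hl
    rw [dist_comm x, dist_comm (p k)]
    linarith
  · rw [if_neg h0, if_neg hl] at *
    linarith

/-! ### Wall crossings of a leg between adjacent rows -/

theorem lineMap_plane_apply (P Q : Plane) (t : ℝ) (i : Fin 2) :
    AffineMap.lineMap P Q t i = P i + t * (Q i - P i) := by
  simp [AffineMap.lineMap_apply]; ring

theorem lineMap_mem_segment_lineMap (P Q : Plane) {a t b : ℝ} (h₁ : a ≤ t) (h₂ : t ≤ b) :
    AffineMap.lineMap P Q t ∈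
      segment ℝ (AffineMap.lineMap P Q a : Plane) (AffineMap.lineMap P Q b) := by
  rw [← image_segment, segment_eq_Icc (h₁.trans h₂)]
  exact ⟨t, ⟨h₁, h₂⟩, rfl⟩

/-- A free point on a vertical wall line has distance more than `r` from the lattice points. -/
theorem lt_abs_sub_of_notMem_scatterer {n : ℕ} (hn : 0 < n) {r : ℝ} {z : Plane} {v j : ℤ}
    (hz : ∀ i, z ∉ scatterer n r i) (hv : z 0 = v) : r < |z 1 - j| := by
  have h := hz (v * n, j)
  rw [scatterer, mem_closedBall_iff_norm, not_le] at h
  refine h.trans_eq ?_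
  rw [← sq_eq_sq₀ (norm_nonneg _) (abs_nonneg _), Plane.norm_sq, sq_abs]
  have hn' : (n : ℝ) ≠ 0 := by positivity
  simp [scattererCenter, hv, hn']

/-- The part of a leg inside a row of tiles, up to the arrival in the last tile `Y`: it crosses at
most one vertical wall. -/
theorem exists_segmentWord_in_strip {n : ℕ} (hn : 0 < n) {r : ℝ} {P Q : Plane} {X Y j : ℤ}
    (hXY : |Y - X| ≤ 1) {t₁ t₂ : ℝ} (h₁ : 0 ≤ t₁) (h₁₂ : t₁ < t₂) (h₂ : t₂ ≤ 1)
    (hPQ : P 1 < Q 1)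
    (hfree : ∀ z ∈ openSegment ℝ P Q, ∀ i : ℤ × ℤ, z ∉ scatterer n r i)
    (hx₁ : (AffineMap.lineMap P Q t₁ : Plane) 0 ∈ Set.Ioo (X : ℝ) (X + 1))
    (hx₂ : (AffineMap.lineMap P Q t₂ : Plane) 0 ∈ Set.Ioo (Y : ℝ) (Y + 1))
    (hy₁ : (j : ℝ) ≤ (AffineMap.lineMap P Q t₁ : Plane) 1)
    (hy₂ : (AffineMap.lineMap P Q t₂ : Plane) 1 ≤ j + 1) :
    ∃ t, t₁ < t ∧ t < t₂ ∧ ⌊(AffineMap.lineMap P Q t : Plane) 0⌋ = Y ∧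
      ⌊(AffineMap.lineMap P Q t : Plane) 1⌋ = j ∧
      SegmentWord n r (AffineMap.lineMap P Q t₁) (AffineMap.lineMap P Q t)
        (FreeGroup.of none ^ (Y - X)) := by
  have hy : ∀ s t : ℝ, s < t →
      (AffineMap.lineMap P Q s : Plane) 1 < (AffineMap.lineMap P Q t : Plane) 1 := by
    intro s t hst
    rw [lineMap_plane_apply, lineMap_plane_apply]
    nlinarith
  have hfl : ∀ t, t₁ ≤ t → t < t₂ → ⌊(AffineMap.lineMap P Q t : Plane) 1⌋ = j := by
    intro t ht ht'
    rw [Int.floor_eq_iff]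
    refine ⟨?_, (hy _ _ ht').trans_le hy₂⟩
    rcases ht.eq_or_lt with rfl | h
    · exact hy₁
    · exact hy₁.trans (hy _ _ h).le
  have hwall : ∀ t, t₁ < t → t < t₂ → ∀ v : ℤ, (AffineMap.lineMap P Q t : Plane) 0 = v →
      (AffineMap.lineMap P Q t : Plane) 1 ∈ Set.Icc ((j : ℝ) + r) (j + 1 - r) := by
    intro t ht ht' v hv
    have hf := hfree _ (lineMap_mem_openSegment ℝ P Q ⟨h₁.trans_lt ht, ht'.trans_le h₂⟩)
    have e1 := lt_abs_sub_of_notMem_scatterer (j := j) hn hf hv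
    have e2 := lt_abs_sub_of_notMem_scatterer (j := j + 1) hn hf hv
    have l1 := hy₁.trans_lt (hy _ _ ht)
    have l2 := (hy _ _ ht').trans_le hy₂
    push_cast at e2
    rw [abs_of_pos (by linarith)] at e1
    rw [abs_of_neg (by linarith)] at e2
    constructor <;> linarith
  obtain ⟨hx₁l, hx₁r⟩ := hx₁
  obtain ⟨hx₂l, hx₂r⟩ := hx₂
  have hcases : Y = X ∨ Y = X + 1 ∨ Y = X - 1 := by
    rw [abs_le] at hXY; omega
  have hmid : t₁ < (t₁ + t₂) / 2 ∧ (t₁ + t₂) / 2 < t₂ := by constructor <;> linarith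
  rcases hcases with rfl | rfl | rfl
  · refine ⟨(t₁ + t₂) / 2, hmid.1, hmid.2, ?_, hfl _ hmid.1.le hmid.2, ?_⟩
    · rw [Int.floor_eq_iff]
      rw [lineMap_plane_apply] at *
      constructor <;> nlinarith
    · rw [sub_self, zpow_zero]
      refine SegmentWord.stay ?_ ?_
      · rw [Int.floor_eq_iff.mpr ⟨hx₁l.le, hx₁r⟩, eq_comm, Int.floor_eq_iff]
        rw [lineMap_plane_apply] at *
        constructor <;> nlinarith
      · rw [hfl _ le_rfl h₁₂, hfl _ hmid.1.le hmid.2]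
  · -- The wall is met at the parameter `s`.  A later point is taken as end point, as a point on
    -- the wall counts as lying to the right of it, which is not the side of the arrival when
    -- the wall is crossed to the left.
    push_cast at hx₂l hx₂r
    have hD : 0 < Q 0 - P 0 := by
      rw [lineMap_plane_apply] at hx₁r hx₂l
      by_contra h
      nlinarith
    obtain ⟨s, hs⟩ : ∃ s : ℝ, (AffineMap.lineMap P Q s : Plane) 0 = ((X + 1 : ℤ) : ℝ) := by
      refine ⟨(X + 1 - P 0) / (Q 0 - P 0), ?_⟩
      rw [lineMap_plane_apply]; push_cast; field_simp; ring
    have hs' := hs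
    rw [lineMap_plane_apply] at hs' hx₁l hx₁r hx₂l hx₂r
    push_cast at hs'
    have hs1 : t₁ < s := by by_contra h; nlinarith
    have hs2 : s < t₂ := by by_contra h; nlinarith
    have hm1 : s < (s + t₂) / 2 := by linarith
    have hm2 : (s + t₂) / 2 < t₂ := by linarith
    have hfx : ⌊(AffineMap.lineMap P Q ((s + t₂) / 2) : Plane) 0⌋ = X + 1 := by
      rw [Int.floor_eq_iff, lineMap_plane_apply]; push_cast
      constructor <;> nlinarith
    have hfx1 : ⌊(AffineMap.lineMap P Q t₁ : Plane) 0⌋ = X := by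
      rw [Int.floor_eq_iff, lineMap_plane_apply]; exact ⟨hx₁l.le, hx₁r⟩
    have hfy1 := hfl _ le_rfl h₁₂
    have hfym := hfl _ (hs1.trans hm1).le hm2
    refine ⟨(s + t₂) / 2, hs1.trans hm1, hm2, hfx, hfym, ?_⟩
    rw [add_sub_cancel_left, zpow_one]
    refine SegmentWord.right (z := AffineMap.lineMap P Q s) (by rw [hfx, hfx1])
      (by rw [hfy1, hfym]) (lineMap_mem_segment_lineMap P Q hs1.le hm1.le) (by rw [hfx, hs]) ?_
    rw [hfy1]
    exact hwall s hs1 hs2 _ hs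
  · push_cast at hx₂l hx₂r
    have hD : Q 0 - P 0 < 0 := by
      rw [lineMap_plane_apply] at hx₁l hx₂r
      by_contra h
      nlinarith
    obtain ⟨s, hs⟩ : ∃ s : ℝ, (AffineMap.lineMap P Q s : Plane) 0 = (X : ℝ) := by
      refine ⟨(X - P 0) / (Q 0 - P 0), ?_⟩
      rw [lineMap_plane_apply]; have := hD.ne; field_simp; ring
    have hs' := hs
    rw [lineMap_plane_apply] at hs' hx₁l hx₁r hx₂l hx₂r
    have hs1 : t₁ < s := by by_contra h; nlinarith
    have hs2 : s < t₂ := by by_contra h; nlinarith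
    have hm1 : s < (s + t₂) / 2 := by linarith
    have hm2 : (s + t₂) / 2 < t₂ := by linarith
    have hfx : ⌊(AffineMap.lineMap P Q ((s + t₂) / 2) : Plane) 0⌋ = X - 1 := by
      rw [Int.floor_eq_iff, lineMap_plane_apply]; push_cast
      constructor <;> nlinarith
    have hfx1 : ⌊(AffineMap.lineMap P Q t₁ : Plane) 0⌋ = X := by
      rw [Int.floor_eq_iff, lineMap_plane_apply]; exact ⟨hx₁l.le, hx₁r⟩
    have hfy1 := hfl _ le_rfl h₁₂
    have hfym := hfl _ (hs1.trans hm1).le hm2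
    refine ⟨(s + t₂) / 2, hs1.trans hm1, hm2, hfx, hfym, ?_⟩
    rw [sub_sub_cancel_left, zpow_neg, zpow_one]
    refine SegmentWord.reverse (SegmentWord.right (z := AffineMap.lineMap P Q s)
      (by rw [hfx, hfx1]; ring) (by rw [hfy1, hfym])
      (by
        rw [segment_symm]; exact lineMap_mem_segment_lineMap P Q hs1.le hm1.le) (by rw [hfx1, hs]) ?_)
    rw [hfym]
    exact hwall s hs1 hs2 _ hs

/-- The word of a leg that goes up from row `j` to row `j + 1`.  If it starts below the line of
row `j`, it crosses this line in the gap `i` of the tile column `X`, and if it ends above the line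
of row `j + 1`, it crosses that line in the gap `i'` of the tile column `Y`. -/
theorem segmentWord_of_upward {n : ℕ} (hn : 0 < n) {r : ℝ} {P Q : Plane} {X Y j : ℤ}
    {i i' : Fin n} (hXY : |Y - X| ≤ 1)
    (hfree : ∀ z ∈ openSegment ℝ P Q, ∀ i : ℤ × ℤ, z ∉ scatterer n r i)
    (hr : 0 < r)
    (hP0 : P 0 ∈ Set.Ioo (X : ℝ) (X + 1)) (hQ0 : Q 0 ∈ Set.Ioo (Y : ℝ) (Y + 1))
    (hP1 : |P 1 - j| < 1 / 2) (hQ1 : |Q 1 - (j + 1)| < 1 / 2)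
    (hPc : P 1 < j → ∀ z ∈ segment ℝ P Q, z 1 = j →
      z 0 ∈ Set.Icc ((X : ℝ) + (i : ℝ) / n + r) (X + ((i : ℝ) + 1) / n - r))
    (hQc : (j : ℝ) + 1 ≤ Q 1 → ∀ z ∈ segment ℝ P Q, z 1 = j + 1 →
      z 0 ∈ Set.Icc ((Y : ℝ) + (i' : ℝ) / n + r) (Y + ((i' : ℝ) + 1) / n - r)) :
    SegmentWord n r P Q ((if (j : ℝ) ≤ P 1 then 1 else FreeGroup.of (some i)) *
      FreeGroup.of none ^ (Y - X) *
        (if (j : ℝ) + 1 ≤ Q 1 then FreeGroup.of (some i') else 1)) := by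
  obtain ⟨hP1l, hP1r⟩ := abs_lt.mp hP1
  obtain ⟨hQ1l, hQ1r⟩ := abs_lt.mp hQ1
  have hPQ : P 1 < Q 1 := by linarith
  have hn' : (0 : ℝ) < n := by positivity
  have hgap : ∀ (Z : ℤ) (l : Fin n) (x : ℝ),
      x ∈ Set.Icc ((Z : ℝ) + (l : ℝ) / n + r) (Z + ((l : ℝ) + 1) / n - r) →
      x ∈ Set.Ioo (Z : ℝ) (Z + 1) := by
    intro Z l x hx
    have h1 : 0 ≤ (l : ℝ) / n := by positivity
    have h2 : ((l : ℝ) + 1) / n ≤ 1 := by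
      rw [div_le_one hn']; exact_mod_cast l.2
    exact ⟨by linarith [hx.1], by linarith [hx.2]⟩
  -- the lower end
  obtain ⟨t₁, ht₁0, hx₁, hy₁, hy₁', hw₁⟩ : ∃ t₁ : ℝ, 0 ≤ t₁ ∧
      (AffineMap.lineMap P Q t₁ : Plane) 0 ∈ Set.Ioo (X : ℝ) (X + 1) ∧
      (j : ℝ) ≤ (AffineMap.lineMap P Q t₁ : Plane) 1 ∧
      (AffineMap.lineMap P Q t₁ : Plane) 1 < j + 1 / 2 ∧
      SegmentWord n r P (AffineMap.lineMap P Q t₁)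
        (if (j : ℝ) ≤ P 1 then 1 else FreeGroup.of (some i)) := by
    by_cases h : (j : ℝ) ≤ P 1
    · refine ⟨0, le_rfl, ?_⟩
      rw [AffineMap.lineMap_apply_zero, if_pos h]
      exact ⟨hP0, h, by linarith, SegmentWord.stay rfl rfl⟩
    · have hlt := not_le.mp h
      have hpos : 0 < Q 1 - P 1 := by linarith
      set t := ((j : ℝ) - P 1) / (Q 1 - P 1) with ht
      have ht0 : 0 ≤ t := div_nonneg (by linarith) hpos.le
      have ht1 : t ≤ 1 := by rw [ht, div_le_one hpos]; linarith
      have hz1 : (AffineMap.lineMap P Q t : Plane) 1 = j := by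
        rw [lineMap_plane_apply, ht]; field_simp; ring
      have hmem : (AffineMap.lineMap P Q t : Plane) ∈ segment ℝ P Q := by
        simpa using lineMap_mem_segment_lineMap P Q ht0 ht1
      have hz0 := hPc hlt _ hmem hz1
      have hf0 : ⌊(AffineMap.lineMap P Q t : Plane) 0⌋ = X :=
        Int.floor_eq_iff.mpr ⟨(hgap _ _ _ hz0).1.le, (hgap _ _ _ hz0).2⟩
      have hfP : ⌊P 0⌋ = X := Int.floor_eq_iff.mpr ⟨hP0.1.le, hP0.2⟩
      have hfP1 : ⌊P 1⌋ = j - 1 := by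
        rw [Int.floor_eq_iff]; push_cast; constructor <;> linarith
      refine ⟨t, ht0, hgap _ _ _ hz0, hz1.ge, by linarith, ?_⟩
      rw [if_neg h]
      refine SegmentWord.up i (by rw [hf0, hfP]) ?_ (right_mem_segment ℝ _ _) ?_ ?_
      · rw [hz1, hfP1, Int.floor_intCast]; ring
      · rw [hz1, Int.floor_intCast]
      · rw [hfP]; exact hz0
  -- the upper end
  obtain ⟨t₂, ht₂1, hx₂, hy₂, hy₂', hw₂⟩ : ∃ t₂ : ℝ, t₂ ≤ 1 ∧
      (AffineMap.lineMap P Q t₂ : Plane) 0 ∈ Set.Ioo (Y : ℝ) (Y + 1) ∧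
      (AffineMap.lineMap P Q t₂ : Plane) 1 ≤ j + 1 ∧
      (j : ℝ) + 1 / 2 ≤ (AffineMap.lineMap P Q t₂ : Plane) 1 ∧
      ∀ t < t₂, ⌊(AffineMap.lineMap P Q t : Plane) 0⌋ = Y →
        ⌊(AffineMap.lineMap P Q t : Plane) 1⌋ = j →
        SegmentWord n r (AffineMap.lineMap P Q t) Q
          (if (j : ℝ) + 1 ≤ Q 1 then FreeGroup.of (some i') else 1) := by
    have hfQ : ⌊Q 0⌋ = Y := Int.floor_eq_iff.mpr ⟨hQ0.1.le, hQ0.2⟩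
    by_cases h : (j : ℝ) + 1 ≤ Q 1
    · have hpos : 0 < Q 1 - P 1 := by linarith
      set t := ((j : ℝ) + 1 - P 1) / (Q 1 - P 1) with ht
      have ht0 : 0 ≤ t := div_nonneg (by linarith) hpos.le
      have ht1 : t ≤ 1 := by rw [ht, div_le_one hpos]; linarith
      have hz1 : (AffineMap.lineMap P Q t : Plane) 1 = j + 1 := by
        rw [lineMap_plane_apply, ht]; field_simp; ring
      have hmem : (AffineMap.lineMap P Q t : Plane) ∈ segment ℝ P Q := by
        simpa using lineMap_mem_segment_lineMap P Q ht0 ht1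
      have hz0 := hQc h _ hmem hz1
      have hfQ1 : ⌊Q 1⌋ = j + 1 := by
        rw [Int.floor_eq_iff]; push_cast; constructor <;> linarith
      refine ⟨t, ht1, hgap _ _ _ hz0, hz1.le, by linarith, ?_⟩
      intro u hu hu0 hu1
      rw [if_pos h]
      refine SegmentWord.up (z := AffineMap.lineMap P Q t) i' (by rw [hfQ, hu0])
        (by rw [hfQ1, hu1]) ?_ ?_ ?_
      · simpa using lineMap_mem_segment_lineMap P Q hu.le ht1
      · rw [hz1, hfQ1]; push_cast; ring
      · rw [hu0]; exact hz0
    · have hlt := not_le.mp h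
      refine ⟨1, le_rfl, ?_⟩
      rw [AffineMap.lineMap_apply_one, if_neg h]
      refine ⟨hQ0, hlt.le, by linarith, ?_⟩
      intro u _ hu0 hu1
      refine SegmentWord.stay (by rw [hu0, hfQ]) ?_
      rw [hu1, eq_comm, Int.floor_eq_iff]
      constructor <;> linarith
  have ht₁₂ : t₁ < t₂ := by
    by_contra h
    rw [lineMap_plane_apply] at hy₁' hy₂'
    nlinarith
  obtain ⟨t, ht₁, ht₂, hf0, hf1, hw⟩ := exists_segmentWord_in_strip hn hXY ht₁0 ht₁₂ ht₂1 hPQ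
    hfree hx₁ hx₂ hy₁ hy₂
  refine SegmentWord.concat (m := AffineMap.lineMap P Q t) ?_
    (SegmentWord.concat (m := AffineMap.lineMap P Q t₁) ?_ hw₁ hw) (hw₂ t ht₂ hf0 hf1)
  · simpa using lineMap_mem_segment_lineMap P Q (ht₁0.trans ht₁.le) (ht₂.le.trans ht₂1)
  · simpa using lineMap_mem_segment_lineMap P Q ht₁0 ht₁.le

/-! ### Itineraries -/

/-- The vertical step, `1` for `true` (upwards) and `-1` for `false` (downwards). -/
def verticalStep (b : Bool) : ℤ := if b then 1 else -1

/-- Combinatorial data from which a sequence of obstacles in successively adjacent rows is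
constructed.  The `k`-th obstacle bounds the gap `gap k` (between the scatterers number `gap k` and
`gap k + 1`) of the tile column `tile k`, and `up k` tells whether the obstacle number `k + 1` lies
one row above or one row below it.  If `up (k + 1) = up k`, the orbit is meant to pass through the
gap while it is reflected from one of its two ends; otherwise it turns back vertically at the left
end of the gap. -/
structure Itinerary (n : ℕ) where
  tile : ℕ → ℤ
  gap : ℕ → Fin n
  up : ℕ → Bool
  tile_step : ∀ k, |tile (k + 1) - tile k| ≤ 1
  near : ∀ k, |(tile (k + 1) * n + gap (k + 1)) - (tile k * n + gap k)| ≤ (n : ℤ) + 1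
  /-- the first obstacle does not lie on a vertical wall line -/
  gap_zero : 0 < (gap 0 : ℕ)
  /-- obstacles at which the orbit turns back do not lie on vertical wall lines -/
  gap_turn : ∀ k, up (k + 1) ≠ up k → 0 < (gap (k + 1) : ℕ)

namespace Itinerary

variable {n : ℕ} (I : Itinerary n)

/-- The horizontal index of the left end of the `k`-th gap. -/
def index (k : ℕ) : ℤ := I.tile k * n + I.gap k

/-- The row of the `k`-th obstacle. -/
def row : ℕ → ℤ
  | 0 => 0
  | k + 1 => row k + verticalStep (I.up k)

/-- The horizontal index of the `k`-th obstacle.  On the way through a gap, that end of the gap is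
chosen from which the orbit is reflected back into the gap: the right end if the neighbouring
obstacles are on average to the left of it, and the left end otherwise. -/
def column : ℕ → ℤ
  | 0 => I.index 0
  | k + 1 => if I.up (k + 1) = I.up k ∧ 0 ≤ 2 * I.index (k + 1) - column k - I.index (k + 2)
      then I.index (k + 1) + 1 else I.index (k + 1)

/-- The `k`-th obstacle. -/
def obstacle (k : ℕ) : ℤ × ℤ := (I.column k, I.row k)

theorem column_eq_or (k : ℕ) : I.column k = I.index k ∨ I.column k = I.index k + 1 := by
  cases k with
  | zero => exact Or.inl rfl
  | succ k => rw [column]; split_ifs <;> simp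

theorem column_of_turn {k : ℕ} (h : I.up (k + 1) ≠ I.up k) :
    I.column (k + 1) = I.index (k + 1) := by
  rw [column, if_neg (fun h' => h h'.1)]

theorem column_of_through {k : ℕ} (h : I.up (k + 1) = I.up k) :
    (I.column (k + 1) = I.index (k + 1) + 1 ∧
        1 ≤ 2 * I.column (k + 1) - I.column k - I.column (k + 2)) ∨
      (I.column (k + 1) = I.index (k + 1) ∧
        2 * I.column (k + 1) - I.column k - I.column (k + 2) ≤ -1) := by
  have h2 := I.column_eq_or (k + 2)
  by_cases h' : 0 ≤ 2 * I.index (k + 1) - I.column k - I.index (k + 2)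
  · have e : I.column (k + 1) = I.index (k + 1) + 1 := by rw [column, if_pos ⟨h, h'⟩]
    left; refine ⟨e, ?_⟩; omega
  · have e : I.column (k + 1) = I.index (k + 1) := by rw [column, if_neg (fun h'' => h' h''.2)]
    right; refine ⟨e, ?_⟩; omega

theorem column_near (k : ℕ) : |I.column (k + 1) - I.column k| ≤ (n : ℤ) + 2 := by
  have h0 := I.column_eq_or k
  have h1 := I.column_eq_or (k + 1)
  have h2 : |I.index (k + 1) - I.index k| ≤ (n : ℤ) + 1 := I.near k
  rw [abs_le] at *
  omega

theorem row_succ (k : ℕ) : I.row (k + 1) = I.row k + verticalStep (I.up k) := rfl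

end Itinerary

theorem verticalStep_eq_or (b : Bool) : verticalStep b = 1 ∨ verticalStep b = -1 := by
  cases b <;> simp [verticalStep]

theorem verticalStep_eq_neg {b b' : Bool} (h : b' ≠ b) : verticalStep b' = -verticalStep b := by
  cases b <;> cases b' <;> simp_all [verticalStep]

/-! ### Admissibility conditions for obstacles in adjacent rows -/

theorem scattererCenter_zero (n : ℕ) (i : ℤ × ℤ) : scattererCenter n i 0 = (i.1 : ℝ) / n := by
  simp [scattererCenter]

theorem scattererCenter_one (n : ℕ) (i : ℤ × ℤ) : scattererCenter n i 1 = (i.2 : ℝ) := by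
  simp [scattererCenter]

theorem abs_intCast_div_le {n : ℕ} (hn : 0 < n) {d : ℤ} {m : ℕ} (h : |d| ≤ m * n) :
    |(d : ℝ) / n| ≤ m := by
  have hn' : (0 : ℝ) < n := by positivity
  rw [abs_div, abs_of_pos hn', div_le_iff₀ hn']
  exact_mod_cast h

theorem inv_le_intCast_div {n : ℕ} {d : ℤ} (h : 1 ≤ d) : 1 / (n : ℝ) ≤ (d : ℝ) / n := by
  have : (1 : ℝ) ≤ d := by exact_mod_cast h
  gcongr

theorem small_radius {n : ℕ} (hn : 0 < n) {r : ℝ} (hr : 100 * n * r ≤ 1) :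
    100 * r ≤ 1 / (n : ℝ) ∧ 100 * r ≤ 1 := by
  have hn' : (1 : ℝ) ≤ n := by exact_mod_cast hn
  have h1 : 100 * r ≤ 1 / (n : ℝ) := by
    rw [le_div_iff₀ (by linarith)]; linarith
  exact ⟨h1, h1.trans (by rw [div_le_one (by linarith)]; exact hn')⟩

/-- Disks with centres in adjacent rows, at a bounded slope, are not separated by a third disk.  In
the two rows, the separating functional is constant along the line through the two centres; it
takes values in `1 / n` times the integers at the centres of each row, up to a constant. -/
theorem hull_disjoint_scatterer {n : ℕ} (hn : 0 < n) {r : ℝ} (hr0 : 0 < r)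
    (hr : 100 * n * r ≤ 1) {x₁ x₂ y s x y' : ℤ} (hs : s = 1 ∨ s = -1) (hx : |x₂ - x₁| ≤ 2 * n)
    (h₁ : (x, y') ≠ (x₁, y)) (h₂ : (x, y') ≠ (x₂, y + s)) :
    Disjoint (convexHull ℝ (scatterer n r (x₁, y) ∪ scatterer n r (x₂, y + s)))
      (scatterer n r (x, y')) := by
  obtain ⟨hrn, hr1⟩ := small_radius hn hr
  have hd : |((x₂ - x₁ : ℤ) : ℝ) / n| ≤ 2 := by exact_mod_cast abs_intCast_div_le hn (m := 2) hx
  set d : ℝ := ((x₂ - x₁ : ℤ) : ℝ) / n with hd'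
  have hdx : (x₂ : ℝ) / n = x₁ / n + d := by rw [hd']; push_cast; ring
  have hs2 : (s : ℝ) * s = 1 := by rcases hs with rfl | rfl <;> norm_num
  have hsabs : |(s : ℝ)| = 1 := by rcases hs with rfl | rfl <;> norm_num
  have hsd : |(s : ℝ) * d| ≤ 2 := by rw [abs_mul, hsabs, one_mul]; exact hd
  have hy : y' = y ∨ y' = y + s ∨ (y + 1 ≤ y' ∧ y + s + 1 ≤ y') ∨
      (y' + 1 ≤ y ∧ y' + 1 ≤ y + s) := by omega
  have hside : ∀ u : ℤ, u ≠ 0 → ∃ σ : ℝ, |σ| = 1 ∧ 1 / (n : ℝ) ≤ σ * (u / n) := by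
    intro u hu
    rcases lt_or_gt_of_ne hu with h | h
    · refine ⟨-1, by norm_num, ?_⟩
      have := inv_le_intCast_div (n := n) (d := -u) (by omega)
      push_cast at this
      linarith [neg_div (n : ℝ) (u : ℝ)]
    · exact ⟨1, by norm_num, by rw [one_mul]; exact inv_le_intCast_div h⟩
  rcases hy with rfl | rfl | ⟨ha, hb⟩ | ⟨ha, hb⟩
  · obtain ⟨σ, hσ, hu⟩ := hside (x - x₁) (by rintro h; exact h₁ (by rw [sub_eq_zero.mp h]))
    push_cast at hu
    have e : |σ * 1| + |σ * -(s * d)| ≤ 3 := by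
      rw [abs_mul, abs_mul, hσ, abs_neg, abs_one]; linarith
    apply disjoint_convexHull_of_linear (σ * 1) (σ * -(s * d)) <;>
      simp only [scattererCenter_zero, scattererCenter_one]
    · have : σ * 1 * ((x : ℝ) / n - x₁ / n) + σ * -(s * d) * (y' - y') = σ * ((x - x₁) / n) := by
        ring
      rw [this]; nlinarith
    · have : σ * 1 * ((x : ℝ) / n - x₂ / n) + σ * -(s * d) * (y' - (y' + s : ℤ)) =
          σ * ((x - x₁) / n) := by
        rw [hdx]; push_cast; linear_combination σ * d * hs2
      rw [this]; nlinarith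
  · obtain ⟨σ, hσ, hu⟩ := hside (x - x₂) (by rintro h; exact h₂ (by rw [sub_eq_zero.mp h]))
    push_cast at hu
    have e : |σ * 1| + |σ * -(s * d)| ≤ 3 := by
      rw [abs_mul, abs_mul, hσ, abs_neg, abs_one]; linarith
    apply disjoint_convexHull_of_linear (σ * 1) (σ * -(s * d)) <;>
      simp only [scattererCenter_zero, scattererCenter_one]
    · have : σ * 1 * ((x : ℝ) / n - x₁ / n) + σ * -(s * d) * ((y + s : ℤ) - y) =
          σ * ((x - x₂) / n) := by
        rw [sub_div, hdx]; push_cast; linear_combination -σ * d * hs2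
      rw [this]; nlinarith
    · have : σ * 1 * ((x : ℝ) / n - x₂ / n) + σ * -(s * d) * ((y + s : ℤ) - (y + s : ℤ)) =
          σ * ((x - x₂) / n) := by
        ring
      rw [this]; nlinarith
  · have ha' : (y : ℝ) + 1 ≤ y' := by exact_mod_cast ha
    have hb' : ((y + s : ℤ) : ℝ) + 1 ≤ y' := by exact_mod_cast hb
    apply disjoint_convexHull_of_linear 0 1 <;>
      simp only [scattererCenter_zero, scattererCenter_one, abs_zero, abs_one] <;> linarith
  · have ha' : (y' : ℝ) + 1 ≤ y := by exact_mod_cast ha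
    have hb' : (y' : ℝ) + 1 ≤ (y + s : ℤ) := by exact_mod_cast hb
    apply disjoint_convexHull_of_linear 0 (-1) <;>
      simp only [scattererCenter_zero, scattererCenter_one, abs_zero, abs_neg, abs_one] <;>
      linarith

theorem turn_disjoint_scatterer {n : ℕ} (hn : 0 < n) {r : ℝ} (hr0 : 0 < r)
    (hr : 100 * n * r ≤ 1) {x₁ x₂ x₃ y s : ℤ} (hs : s = 1 ∨ s = -1) :
    Disjoint (scatterer n r (x₂, y))
      (convexHull ℝ (scatterer n r (x₁, y + s) ∪ scatterer n r (x₃, y + s))) := by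
  obtain ⟨hrn, hr1⟩ := small_radius hn hr
  refine Disjoint.symm ?_
  have hs2 : (s : ℝ) * s = 1 := by rcases hs with rfl | rfl <;> norm_num
  have hsabs : |(s : ℝ)| = 1 := by rcases hs with rfl | rfl <;> norm_num
  apply disjoint_convexHull_of_linear 0 (-s) <;>
    simp only [scattererCenter_zero, scattererCenter_one, abs_zero, abs_neg, hsabs] <;>
    push_cast <;> linarith

/-- An obstacle in the row between two others is disjoint from their convex hull if it is not the
midpoint: the horizontal distance from the midpoint is then at least `1 / (2 n)`. -/
theorem through_disjoint_scatterer {n : ℕ} (hn : 0 < n) {r : ℝ} (hr0 : 0 < r)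
    (hr : 100 * n * r ≤ 1) {x₁ x₂ x₃ y s : ℤ} (hs : s = 1 ∨ s = -1) (hx : |x₃ - x₁| ≤ 4 * n)
    (h : 1 ≤ 2 * x₂ - x₁ - x₃ ∨ 2 * x₂ - x₁ - x₃ ≤ -1) :
    Disjoint (scatterer n r (x₂, y))
      (convexHull ℝ (scatterer n r (x₁, y - s) ∪ scatterer n r (x₃, y + s))) := by
  obtain ⟨hrn, hr1⟩ := small_radius hn hr
  refine Disjoint.symm ?_
  have hd : |((x₃ - x₁ : ℤ) : ℝ) / n| ≤ 4 := by exact_mod_cast abs_intCast_div_le hn (m := 4) hx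
  set d : ℝ := ((x₃ - x₁ : ℤ) : ℝ) / n with hd'
  have hdx : (x₃ : ℝ) / n = x₁ / n + d := by rw [hd']; push_cast; ring
  have hs2 : (s : ℝ) * s = 1 := by rcases hs with rfl | rfl <;> norm_num
  have hsabs : |(s : ℝ)| = 1 := by rcases hs with rfl | rfl <;> norm_num
  obtain ⟨σ, hσ, hu⟩ : ∃ σ : ℝ, |σ| = 1 ∧ 1 / (n : ℝ) ≤ σ * (2 * x₂ / n - x₁ / n - x₃ / n) := by
    rcases h with h | h
    · refine ⟨1, by norm_num, (inv_le_intCast_div h).trans_eq ?_⟩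
      push_cast; ring
    · refine ⟨-1, by norm_num, (inv_le_intCast_div (d := -(2 * x₂ - x₁ - x₃))
        (by omega)).trans_eq ?_⟩
      push_cast; ring
  have e : |σ * 2| + |σ * -(s * d)| ≤ 6 := by
    rw [abs_mul, abs_mul, hσ, abs_neg, abs_mul, hsabs, abs_two]; linarith
  apply disjoint_convexHull_of_linear (σ * 2) (σ * -(s * d)) <;>
    simp only [scattererCenter_zero, scattererCenter_one] <;> push_cast
  · have : σ * 2 * ((x₂ : ℝ) / n - x₁ / n) + σ * -(s * d) * (y - (y - s)) =
        σ * (2 * x₂ / n - x₁ / n - x₃ / n) := by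
      rw [hdx]; linear_combination -σ * d * hs2
    rw [this]; nlinarith
  · have : σ * 2 * ((x₂ : ℝ) / n - x₃ / n) + σ * -(s * d) * (y - (y + s)) =
        σ * (2 * x₂ / n - x₁ / n - x₃ / n) := by
      rw [hdx]; linear_combination σ * d * hs2
    rw [this]; nlinarith

/-! ### Location of the collision points -/

theorem div_sqrt_add_div_sqrt_neg {a b h k : ℝ} (hh : 0 < h) (hk : 0 < k)
    (hab : a * k + b * h < 0) : a / √(a ^ 2 + h ^ 2) + b / √(b ^ 2 + k ^ 2) < 0 := by
  have key : ∀ {a b h k : ℝ}, 0 < h → 0 < k → a < 0 → a * k + b * h < 0 →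
      a / √(a ^ 2 + h ^ 2) + b / √(b ^ 2 + k ^ 2) < 0 := by
    intro a b h k hh hk ha hab
    have hN : 0 < √(a ^ 2 + h ^ 2) := by positivity
    have hM : 0 < √(b ^ 2 + k ^ 2) := by positivity
    rw [div_add_div _ _ hN.ne' hM.ne']
    apply div_neg_of_neg_of_pos _ (by positivity)
    rcases le_or_gt b 0 with hb | hb
    · nlinarith [mul_pos (neg_pos.mpr ha) hM, mul_nonneg hN.le (neg_nonneg.mpr hb)]
    · have h1 : √(a ^ 2 + h ^ 2) * b < -a * √(b ^ 2 + k ^ 2) := by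
        apply lt_of_pow_lt_pow_left₀ 2 (by nlinarith [mul_pos (neg_pos.mpr ha) hM])
        rw [mul_pow, mul_pow, Real.sq_sqrt (by positivity), Real.sq_sqrt (by positivity)]
        have h2 : (b * h) ^ 2 < (-a * k) ^ 2 := by
          apply pow_lt_pow_left₀ (by linarith) (by positivity) (by norm_num)
        nlinarith
      linarith
  have : a < 0 ∨ b < 0 := by
    by_contra hcon
    push Not at hcon
    nlinarith [mul_nonneg hcon.1 hk.le, mul_nonneg hcon.2 hh.le]
  rcases this with ha | hb
  · exact key hh hk ha hab
  · rw [add_comm]; exact key hk hh hb (by linarith)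

theorem direction_apply (p A : Plane) (i : Fin 2) :
    direction p A i = (A i - p i) / √((A 0 - p 0) ^ 2 + (A 1 - p 1) ^ 2) := by
  rw [← Plane.dist_eq, _root_.dist_eq_norm, direction]
  simp [div_eq_inv_mul]

theorem abs_sub_le_of_mem_sphere {c p : Plane} {r : ℝ} (hp : p ∈ Metric.sphere c r) (i : Fin 2) :
    |p i - c i| ≤ r := by
  rw [mem_sphere_iff_norm] at hp
  rw [← hp]; exact Plane.abs_apply_le (p - c) i

/-- A collision point between neighbours below and above that are on average to the left of the
obstacle lies on the left half of its boundary. -/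
theorem normal_neg_of_mean_neg {c cA cB p A B : Plane} {r κ δ s : ℝ} (hκ : 0 < κ)
    (hs : s = 1 ∨ s = -1) (hδ : 16 * r < δ) (hr : 16 * r ≤ 1) (hr0 : 0 < r)
    (hp : p ∈ Metric.sphere c r) (hA : A ∈ Metric.sphere cA r) (hB : B ∈ Metric.sphere cB r)
    (h : p - c = κ • (direction p A + direction p B))
    (hA0 : |cA 0 - c 0| ≤ 2) (hB0 : |cB 0 - c 0| ≤ 2)
    (hA1 : cA 1 = c 1 - s) (hB1 : cB 1 = c 1 + s)
    (hmean : δ ≤ 2 * c 0 - cA 0 - cB 0) : p 0 - c 0 < 0 := by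
  have e : p 0 - c 0 = κ * (direction p A 0 + direction p B 0) := by
    have := congrArg (fun v : Plane => v 0) h
    rw [mul_add]; simpa using this
  rw [e]
  apply mul_neg_of_pos_of_neg hκ
  rw [direction_apply, direction_apply]
  have p0 := abs_le.mp (abs_sub_le_of_mem_sphere hp 0)
  have p1 := abs_le.mp (abs_sub_le_of_mem_sphere hp 1)
  have a0 := abs_le.mp (abs_sub_le_of_mem_sphere hA 0)
  have a1 := abs_le.mp (abs_sub_le_of_mem_sphere hA 1)
  have b0 := abs_le.mp (abs_sub_le_of_mem_sphere hB 0)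
  have b1 := abs_le.mp (abs_sub_le_of_mem_sphere hB 1)
  have hA0 := abs_le.mp hA0
  have hB0 := abs_le.mp hB0
  have hs2 : s ^ 2 = 1 := by rcases hs with rfl | rfl <;> norm_num
  have hsa : |-s * (A 1 - p 1) - 1| ≤ 2 * r ∧ |s * (B 1 - p 1) - 1| ≤ 2 * r := by
    rw [abs_le, abs_le]
    rcases hs with rfl | rfl <;> refine ⟨⟨?_, ?_⟩, ?_, ?_⟩ <;> linarith
  obtain ⟨ha, hb⟩ := hsa
  rw [abs_le] at ha hb
  have eA : (A 1 - p 1) ^ 2 = (-s * (A 1 - p 1)) ^ 2 := by rw [mul_pow, neg_sq, hs2, one_mul]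
  have eB : (B 1 - p 1) ^ 2 = (s * (B 1 - p 1)) ^ 2 := by rw [mul_pow, hs2, one_mul]
  rw [eA, eB]
  apply div_sqrt_add_div_sqrt_neg (by linarith) (by linarith)
  set u := -s * (A 1 - p 1)
  set v := s * (B 1 - p 1)
  have hα : |A 0 - p 0| ≤ 3 := by rw [abs_le]; constructor <;> linarith
  have hβ : |B 0 - p 0| ≤ 3 := by rw [abs_le]; constructor <;> linarith
  have h1 : (A 0 - p 0) * (v - 1) ≤ 3 * (2 * r) :=
    (le_abs_self _).trans (by rw [abs_mul]; gcongr; rw [abs_le]; exact hb)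
  have h2 : (B 0 - p 0) * (u - 1) ≤ 3 * (2 * r) :=
    (le_abs_self _).trans (by rw [abs_mul]; gcongr; rw [abs_le]; exact ha)
  nlinarith

theorem normal_pos_of_mean_pos {c cA cB p A B : Plane} {r κ δ s : ℝ} (hκ : 0 < κ)
    (hs : s = 1 ∨ s = -1) (hδ : 16 * r < δ) (hr : 16 * r ≤ 1) (hr0 : 0 < r)
    (hp : p ∈ Metric.sphere c r) (hA : A ∈ Metric.sphere cA r) (hB : B ∈ Metric.sphere cB r)
    (h : p - c = κ • (direction p A + direction p B))
    (hA0 : |cA 0 - c 0| ≤ 2) (hB0 : |cB 0 - c 0| ≤ 2)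
    (hA1 : cA 1 = c 1 - s) (hB1 : cB 1 = c 1 + s)
    (hmean : 2 * c 0 - cA 0 - cB 0 ≤ -δ) : 0 < p 0 - c 0 := by
  -- rotate the configuration by a half turn
  have hd : ∀ q : Plane, direction (-p) (-q) = -direction p q := by
    intro q
    rw [direction, direction, ← smul_neg]
    congr 2
    · rw [← norm_neg]; congr 1; abel
    · abel
  have hsph : ∀ {x y : Plane}, x ∈ Metric.sphere y r → -x ∈ Metric.sphere (-y) r := by
    intro x y hx
    rw [mem_sphere_iff_norm] at *
    rw [← hx, ← norm_neg]; congr 1; abel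
  have := normal_neg_of_mean_neg (c := -c) (cA := -cA) (cB := -cB) (p := -p) (A := -A) (B := -B)
    (s := -s) hκ (by rcases hs with rfl | rfl <;> norm_num) hδ hr hr0 (hsph hp) (hsph hA)
    (hsph hB) (by rw [hd, hd, ← neg_add, smul_neg, ← h]; abel)
    (by simp only [PiLp.neg_apply]; rw [neg_sub_neg, abs_sub_comm]; exact hA0)
    (by simp only [PiLp.neg_apply]; rw [neg_sub_neg, abs_sub_comm]; exact hB0)
    (by simp only [PiLp.neg_apply]; rw [hA1]; ring)
    (by simp only [PiLp.neg_apply]; rw [hB1]; ring)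
    (by simp only [PiLp.neg_apply]; linarith)
  simp only [PiLp.neg_apply] at this
  linarith

/-- A collision point both neighbours of which lie above (`s = 1`) or below (`s = -1`) the obstacle
lies on the upper or lower half of its boundary. -/
theorem normal_vertical_pos {c p A B : Plane} {κ s : ℝ} (hκ : 0 < κ)
    (h : p - c = κ • (direction p A + direction p B))
    (hA : 0 < s * (A 1 - p 1)) (hB : 0 < s * (B 1 - p 1)) : 0 < s * (p 1 - c 1) := by
  have e : p 1 - c 1 = κ * (direction p A 1 + direction p B 1) := by
    have := congrArg (fun v : Plane => v 1) h
    rw [mul_add]; simpa using this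
  have key : ∀ q : Plane, 0 < s * (q 1 - p 1) → 0 < s * direction p q 1 := by
    intro q hq
    have hne : q 1 - p 1 ≠ 0 := by intro h0; rw [h0] at hq; simp at hq
    rw [direction_apply, ← mul_div_assoc]
    apply div_pos hq
    have := sq_pos_of_ne_zero hne
    positivity
  rw [e]
  have := key A hA
  have := key B hB
  calc (0 : ℝ) < κ * (s * direction p A 1 + s * direction p B 1) := by positivity
    _ = _ := by ring

/-- Where a leg that leaves an obstacle outwards crosses the row of the obstacle: on the same side
of the obstacle as the collision point, outside of the obstacle but close to it. -/
theorem row_crossing {c p Q z : Plane} {r : ℝ} (hr0 : 0 < r) (hp : p ∈ Metric.sphere c r)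
    (hin : 0 ≤ inner ℝ (Q - p) (p - c)) (hslope : |Q 0 - p 0| ≤ 3 * |Q 1 - p 1|)
    (hz : z ∈ segment ℝ p Q) (hz1 : z 1 = c 1) :
    (p 0 - c 0 < 0 → r ≤ c 0 - z 0 ∧ c 0 - z 0 ≤ 4 * r) ∧
      (0 < p 0 - c 0 → r ≤ z 0 - c 0 ∧ z 0 - c 0 ≤ 4 * r) := by
  have p0 := abs_sub_le_of_mem_sphere hp 0
  have p1 := abs_sub_le_of_mem_sphere hp 1
  have hpr : (p 0 - c 0) ^ 2 + (p 1 - c 1) ^ 2 = r ^ 2 := by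
    rw [← mem_sphere_iff_norm.mp hp, Plane.norm_sq]; simp
  rw [segment_eq_image_lineMap] at hz
  obtain ⟨t, ⟨ht0, ht1⟩, rfl⟩ := hz
  rw [Plane.inner_eq] at hin
  simp only [PiLp.sub_apply] at hin
  rw [lineMap_plane_apply] at hz1
  simp only [lineMap_plane_apply]
  have hσ : r ^ 2 ≤ (p 0 + t * (Q 0 - p 0) - c 0) * (p 0 - c 0) := by
    have h1 : (p 1 + t * (Q 1 - p 1) - c 1) * (p 1 - c 1) = 0 := by rw [hz1]; ring
    nlinarith [mul_nonneg ht0 hin]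
  have hmove : |t * (Q 0 - p 0)| ≤ 3 * r := by
    have h1 : |t * (Q 1 - p 1)| ≤ r := by
      have : t * (Q 1 - p 1) = -(p 1 - c 1) := by linarith
      rw [this, abs_neg]; exact p1
    rw [abs_mul, abs_of_nonneg ht0] at h1 ⊢
    nlinarith [mul_le_mul_of_nonneg_left hslope ht0]
  rw [abs_le] at hmove p0
  constructor <;> intro h
  · refine ⟨?_, by linarith⟩
    by_contra hcon
    nlinarith
  · refine ⟨?_, by linarith⟩
    by_contra hcon
    nlinarith

/-! ### The billiard orbit of an itinerary -/

namespace Itinerary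

variable {n : ℕ} (I : Itinerary n)

/-- Either both neighbours of the `k`-th obstacle lie in the row towards which `up k` points, or
the orbit passes through a gap. -/
theorem turn_or_through {L : ℕ} (hL : 0 < L) (hturn : I.up L ≠ I.up (L - 1)) {k : ℕ}
    (hk : k ≤ L) :
    (I.row (prevIndex k) = I.row k + verticalStep (I.up k) ∧
        I.row (nextIndex L k) = I.row k + verticalStep (I.up k) ∧
        I.column k = I.index k ∧ 0 < (I.gap k : ℕ)) ∨
      ∃ j, k = j + 1 ∧ prevIndex k = j ∧ nextIndex L k = j + 2 ∧ I.up (j + 1) = I.up j := by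
  rcases Nat.eq_zero_or_pos k with rfl | h0
  · left
    refine ⟨rfl, ?_, rfl, I.gap_zero⟩
    rw [nextIndex, if_neg hL.ne]; rfl
  · obtain ⟨j, rfl⟩ := Nat.exists_eq_add_of_le' h0
    have hprev : prevIndex (j + 1) = j := rfl
    rcases eq_or_ne (j + 1) L with rfl | hl
    · have ht : I.up (j + 1) ≠ I.up j := hturn
      left
      rw [hprev, nextIndex, if_pos rfl, Nat.add_sub_cancel, row_succ, verticalStep_eq_neg ht]
      exact ⟨by ring, by ring, I.column_of_turn ht, I.gap_turn j ht⟩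
    · have hnext : nextIndex L (j + 1) = j + 2 := by rw [nextIndex, if_neg hl]
      by_cases ht : I.up (j + 1) = I.up j
      · exact Or.inr ⟨j, rfl, hprev, hnext, ht⟩
      · left
        rw [hprev, hnext, I.row_succ (j + 1), row_succ, verticalStep_eq_neg ht]
        exact ⟨by ring, by ring, I.column_of_turn ht, I.gap_turn j ht⟩

theorem column_prev_near {k : ℕ} (hn : 2 ≤ n) :
    |I.column (prevIndex k) - I.column k| ≤ 2 * n := by
  rcases Nat.eq_zero_or_pos k with rfl | h0
  · have := I.column_near 0
    exact this.trans (by omega)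
  · obtain ⟨j, rfl⟩ := Nat.exists_eq_add_of_le' h0
    have := I.column_near j
    rw [abs_sub_comm]
    exact this.trans (by omega)

theorem column_next_near {L k : ℕ} (hn : 2 ≤ n) (hL : 0 < L) :
    |I.column (nextIndex L k) - I.column k| ≤ 2 * n := by
  rw [nextIndex]
  split_ifs with h
  · obtain ⟨j, rfl⟩ := Nat.exists_eq_add_of_le' (h ▸ hL : 0 < k)
    have := I.column_near j
    rw [← h, Nat.add_sub_cancel, abs_sub_comm]
    exact this.trans (by omega)
  · exact (I.column_near k).trans (by omega)

theorem row_sub_eq_or {L k : ℕ} (hL : 0 < L) :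
    (I.row (prevIndex k) - I.row k = 1 ∨ I.row (prevIndex k) - I.row k = -1) ∧
      (I.row (nextIndex L k) - I.row k = 1 ∨ I.row (nextIndex L k) - I.row k = -1) := by
  have key : ∀ j, (I.row (j + 1) - I.row j = 1 ∨ I.row (j + 1) - I.row j = -1) := by
    intro j
    rw [row_succ, add_sub_cancel_left]; exact verticalStep_eq_or _
  constructor
  · rcases Nat.eq_zero_or_pos k with rfl | h0
    · exact key 0
    · obtain ⟨j, rfl⟩ := Nat.exists_eq_add_of_le' h0
      have := key j
      change I.row j - I.row (j + 1) = 1 ∨ I.row j - I.row (j + 1) = -1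
      omega
  · rw [nextIndex]
    split_ifs with h
    · obtain ⟨j, rfl⟩ := Nat.exists_eq_add_of_le' (h ▸ hL : 0 < k)
      have := key j
      rw [← h]
      change I.row j - I.row (j + 1) = 1 ∨ I.row j - I.row (j + 1) = -1
      omega
    · exact key k

theorem center_zero (k : ℕ) : scattererCenter n (I.obstacle k) 0 = (I.column k : ℝ) / n :=
  scattererCenter_zero n _

theorem center_one (k : ℕ) : scattererCenter n (I.obstacle k) 1 = (I.row k : ℝ) :=
  scattererCenter_one n _

theorem hull_disjoint (hn : 2 ≤ n) {r : ℝ} (hr0 : 0 < r) (hr : 100 * n * r ≤ 1) (k : ℕ)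
    {i : ℤ × ℤ} (h : i ≠ I.obstacle k) (h' : i ≠ I.obstacle (k + 1)) :
    Disjoint (convexHull ℝ (scatterer n r (I.obstacle k) ∪ scatterer n r (I.obstacle (k + 1))))
      (scatterer n r i) :=
  hull_disjoint_scatterer (by omega) hr0 hr (verticalStep_eq_or _)
    ((I.column_near k).trans (by omega)) h h'

theorem turn_disjoint (hn : 2 ≤ n) {r : ℝ} (hr0 : 0 < r) (hr : 100 * n * r ≤ 1) {L : ℕ}
    (hL : 0 < L) (hturn : I.up L ≠ I.up (L - 1)) {k : ℕ} (hk : k ≤ L) :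
    Disjoint (scatterer n r (I.obstacle k)) (convexHull ℝ
      (scatterer n r (I.obstacle (prevIndex k)) ∪
        scatterer n r (I.obstacle (nextIndex L k)))) := by
  rcases I.turn_or_through hL hturn hk with ⟨h1, h2, -, -⟩ | ⟨j, rfl, h1, h2, h3⟩
  · simp only [obstacle, h1, h2]
    exact turn_disjoint_scatterer (by omega) hr0 hr (verticalStep_eq_or _)
  · rw [h1, h2]
    have e1 : I.obstacle j = (I.column j, I.row (j + 1) - verticalStep (I.up j)) := by
      simp [obstacle, row_succ]
    have e2 : I.obstacle (j + 2) = (I.column (j + 2), I.row (j + 1) + verticalStep (I.up j)) := by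
      rw [obstacle, I.row_succ (j + 1), h3]
    rw [e1, e2]
    have c1 := I.column_near j
    have c2 := I.column_near (j + 1)
    refine through_disjoint_scatterer (by omega) hr0 hr (verticalStep_eq_or _) ?_ ?_
    · rw [show j + 1 + 1 = j + 2 from rfl] at c2
      rw [abs_le] at *; omega
    · exact (I.column_of_through h3).imp And.right And.right

section Shortest

variable {I} {r : ℝ} {L : ℕ} {p : ℕ → Plane}

theorem notMem_ball_of_row {k q : ℕ} (hr1 : 100 * r ≤ 1)
    (hp : ∀ k, p k ∈ Metric.sphere (scattererCenter n (I.obstacle k)) r)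
    (h : I.row q - I.row k = 1 ∨ I.row q - I.row k = -1) :
    p q ∉ Metric.closedBall (scattererCenter n (I.obstacle k)) r := by
  intro hmem
  rw [mem_closedBall_iff_norm] at hmem
  have h1 := abs_le.mp ((Plane.abs_apply_le _ 1).trans hmem)
  have h2 := abs_le.mp (abs_sub_le_of_mem_sphere (hp q) 1)
  simp only [PiLp.sub_apply, center_one] at h1 h2
  rcases h with h | h
  · have : (I.row q : ℝ) - I.row k = 1 := by exact_mod_cast h
    linarith
  · have : (I.row q : ℝ) - I.row k = -1 := by exact_mod_cast h
    linarith

variable (I r L p) in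
/-- `p` is a shortest polygon visiting the obstacles of the itinerary `I` up to the one with number
`L`, where the itinerary turns back; the scatterers are small compared with their distances. -/
structure IsBilliardPolygon : Prop extends IsShortestPolygon n r I.obstacle L p where
  two_le : 2 ≤ n
  radius_pos : 0 < r
  radius_le : 100 * n * r ≤ 1
  legs_pos : 0 < L
  turn_last : I.up L ≠ I.up (L - 1)

namespace IsBilliardPolygon

theorem notMem_segment (h : I.IsBilliardPolygon r L p) {k : ℕ} (hk : k ≤ L) :
    p k ∉ segment ℝ (p (prevIndex k)) (p (nextIndex L k)) := by
  intro hmem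
  refine Set.disjoint_left.mp (I.turn_disjoint h.two_le h.radius_pos h.radius_le h.legs_pos
    h.turn_last hk) (Metric.sphere_subset_closedBall (h.mem_sphere k)) ?_
  refine (convex_convexHull ℝ
      (_ : Set Plane)).segment_subset (subset_convexHull ℝ _ (Or.inl ?_))
    (subset_convexHull ℝ _ (Or.inr ?_)) hmem
  · exact Metric.sphere_subset_closedBall (h.mem_sphere _)
  · exact Metric.sphere_subset_closedBall (h.mem_sphere _)

theorem exists_normal (h : I.IsBilliardPolygon r L p) {k : ℕ} (hk : k ≤ L) :
    ∃ κ : ℝ, 0 < κ ∧ p k - scattererCenter n (I.obstacle k) =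
      κ • (direction (p k) (p (prevIndex k)) + direction (p k) (p (nextIndex L k))) := by
  have hr1 := (small_radius (zero_lt_two.trans_le h.two_le) h.radius_le).2
  exact exists_normal_eq_bisector h.radius_pos (h.mem_sphere k)
    (notMem_ball_of_row hr1 h.mem_sphere (I.row_sub_eq_or h.legs_pos).1)
    (notMem_ball_of_row hr1 h.mem_sphere (I.row_sub_eq_or h.legs_pos).2)
    (fun x hx => h.local_min h.legs_pos hk hx) (h.notMem_segment hk)

theorem free_flight (h : I.IsBilliardPolygon r L p) {k : ℕ} (hk : k < L) {z : Plane}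
    (hz : z ∈ openSegment ℝ (p k) (p (k + 1))) (i : ℤ × ℤ) : z ∉ scatterer n r i := by
  have hr1 := (small_radius (zero_lt_two.trans_le h.two_le) h.radius_le).2
  have hnext : nextIndex L k = k + 1 := by rw [nextIndex, if_neg hk.ne]
  have hprev : prevIndex (k + 1) = k := rfl
  by_cases h₁ : i = I.obstacle k
  · subst h₁
    refine notMem_closedBall_of_shortest (A := p (k + 1)) (B := p (prevIndex k)) (p := p k)
      ?_ ?_ ?_ z (openSegment_symm ℝ (p k) _ ▸ hz)
    · rw [← hnext]
      exact notMem_ball_of_row hr1 h.mem_sphere (I.row_sub_eq_or h.legs_pos).2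
    · intro x hx
      have := h.local_min h.legs_pos hk.le hx
      rw [hnext] at this
      rw [dist_comm _ (p k), dist_comm (p k) (p (prevIndex k)), dist_comm _ x,
        dist_comm x (p (prevIndex k))]
      linarith
    · have := h.notMem_segment hk.le
      rwa [segment_symm, hnext] at this
  · by_cases h₂ : i = I.obstacle (k + 1)
    · subst h₂
      refine notMem_closedBall_of_shortest (A := p k) (B := p (nextIndex L (k + 1)))
        (p := p (k + 1)) ?_ ?_ ?_ z hz
      · rw [← hprev]
        exact notMem_ball_of_row hr1 h.mem_sphere (I.row_sub_eq_or h.legs_pos).1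
      · exact fun x hx => h.local_min h.legs_pos hk hx
      · exact h.notMem_segment hk
    · refine Set.disjoint_left.mp (I.hull_disjoint h.two_le h.radius_pos h.radius_le k h₁ h₂) ?_
      refine (convex_convexHull ℝ
      (_ : Set Plane)).segment_subset (subset_convexHull ℝ _ (Or.inl ?_))
        (subset_convexHull ℝ _ (Or.inr ?_)) (openSegment_subset_segment ℝ _ _ hz)
      · exact Metric.sphere_subset_closedBall (h.mem_sphere _)
      · exact Metric.sphere_subset_closedBall (h.mem_sphere _)

theorem vertical_distance (h : I.IsBilliardPolygon r L p) {k q : ℕ}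
    (hq : I.row q - I.row k = 1 ∨ I.row q - I.row k = -1)
    (s : ℝ) (hs : (I.row q : ℝ) = I.row k + s) : 0 < s * (p q 1 - p k 1) := by
  have hr1 := (small_radius (zero_lt_two.trans_le h.two_le) h.radius_le).2
  have h1 := abs_le.mp (abs_sub_le_of_mem_sphere (h.mem_sphere q) 1)
  have h2 := abs_le.mp (abs_sub_le_of_mem_sphere (h.mem_sphere k) 1)
  rw [center_one] at h1 h2
  rcases hq with hq | hq
  · have : (I.row q : ℝ) - I.row k = 1 := by exact_mod_cast hq
    have : s = 1 := by linarith
    subst this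
    linarith
  · have : (I.row q : ℝ) - I.row k = -1 := by exact_mod_cast hq
    have : s = -1 := by linarith
    subst this
    linarith

end IsBilliardPolygon

end Shortest

end Itinerary

theorem ne_of_notMem_segment {x a b : Plane} (h : x ∉ segment ℝ a b) : x ≠ a ∧ x ≠ b := by
  constructor <;> rintro rfl
  · exact h (left_mem_segment ℝ _ _)
  · exact h (right_mem_segment ℝ _ _)

theorem abs_div_sub_div_le_two {n : ℕ} (hn : 0 < n) {x y : ℤ} (h : |x - y| ≤ 2 * n) :
    |(x : ℝ) / n - (y : ℝ) / n| ≤ 2 := by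
  have := abs_intCast_div_le hn (m := 2) h
  rwa [Int.cast_sub, sub_div, Nat.cast_ofNat] at this

namespace Itinerary.IsBilliardPolygon

variable {n : ℕ} {I : Itinerary n} {r : ℝ} {L : ℕ} {p : ℕ → Plane}

/-- On the way through a gap, the orbit is reflected inside the gap. -/
theorem normal_of_through (h : I.IsBilliardPolygon r L p) {j : ℕ} (hj : j + 1 < L)
    (hup : I.up (j + 1) = I.up j) :
    (I.column (j + 1) = I.index (j + 1) + 1 ∧ p (j + 1) 0 - (I.column (j + 1) : ℝ) / n < 0) ∨
      (I.column (j + 1) = I.index (j + 1) ∧ 0 < p (j + 1) 0 - (I.column (j + 1) : ℝ) / n) := by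
  have hn0 : 0 < n := zero_lt_two.trans_le h.two_le
  obtain ⟨hrn, hr1⟩ := small_radius hn0 h.radius_le
  have hr0 := h.radius_pos
  obtain ⟨κ, hκ, hnormal⟩ := h.exists_normal hj.le
  have hprev : prevIndex (j + 1) = j := rfl
  have hnext : nextIndex L (j + 1) = j + 2 := by rw [nextIndex, if_neg hj.ne]
  have hA0 := I.column_prev_near (k := j + 1) h.two_le
  have hB0 := I.column_next_near (k := j + 1) h.two_le h.legs_pos
  rw [hprev, hnext] at hnormal
  rw [hprev] at hA0
  rw [hnext] at hB0
  have hs : ((verticalStep (I.up j) : ℤ) : ℝ) = 1 ∨ ((verticalStep (I.up j) : ℤ) : ℝ) = -1 := by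
    rcases verticalStep_eq_or (I.up j) with e | e <;> simp [e]
  have hnear : ∀ q, |I.column q - I.column (j + 1)| ≤ 2 * n →
      |scattererCenter n (I.obstacle q) 0 - scattererCenter n (I.obstacle (j + 1)) 0| ≤ 2 := by
    intro q hq
    rw [center_zero, center_zero]
    exact abs_div_sub_div_le_two hn0 hq
  have hA1 : scattererCenter n (I.obstacle j) 1 =
      scattererCenter n (I.obstacle (j + 1)) 1 - (verticalStep (I.up j) : ℤ) := by
    rw [center_one, center_one, row_succ]; push_cast; ring
  have hB1 : scattererCenter n (I.obstacle (j + 2)) 1 =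
      scattererCenter n (I.obstacle (j + 1)) 1 + (verticalStep (I.up j) : ℤ) := by
    rw [center_one, center_one, I.row_succ (j + 1), hup]; push_cast; ring
  rcases I.column_of_through hup with ⟨hc, hm⟩ | ⟨hc, hm⟩
  · refine Or.inl ⟨hc, ?_⟩
    have := normal_neg_of_mean_neg (δ := 1 / n) hκ hs (by linarith) (by linarith) hr0
      (h.mem_sphere _) (h.mem_sphere _) (h.mem_sphere _) hnormal (hnear _ hA0) (hnear _ hB0) hA1
      hB1 (by
        simp only [center_zero]
        refine (inv_le_intCast_div hm).trans_eq ?_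
        push_cast; ring)
    rwa [center_zero] at this
  · refine Or.inr ⟨hc, ?_⟩
    have := normal_pos_of_mean_pos (δ := 1 / n) hκ hs (by linarith) (by linarith) hr0
      (h.mem_sphere _) (h.mem_sphere _) (h.mem_sphere _) hnormal (hnear _ hA0) (hnear _ hB0) hA1
      hB1 (by
        simp only [center_zero]
        have e := inv_le_intCast_div (n := n)
          (d := -(2 * I.column (j + 1) - I.column j - I.column (j + 2))) (by omega)
        push_cast at e
        refine le_neg_of_le_neg (e.trans_eq ?_)
        ring)
    rwa [center_zero] at this

theorem index_div (h : I.IsBilliardPolygon r L p) (k : ℕ) :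
    (I.index k : ℝ) / n = I.tile k + (I.gap k : ℝ) / n := by
  have : (n : ℝ) ≠ 0 := by have := h.two_le; positivity
  rw [index]; push_cast; field_simp

/-- The collision points lie in the interiors of the tile columns. -/
theorem mem_tile (h : I.IsBilliardPolygon r L p) {k : ℕ} (hk : k ≤ L) :
    p k 0 ∈ Set.Ioo (I.tile k : ℝ) (I.tile k + 1) := by
  have hn0 : 0 < n := zero_lt_two.trans_le h.two_le
  have hn' : (0 : ℝ) < n := by exact_mod_cast hn0
  obtain ⟨hrn, hr1⟩ := small_radius hn0 h.radius_le
  have hr0 := h.radius_pos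
  have hs := abs_le.mp (abs_sub_le_of_mem_sphere (h.mem_sphere k) 0)
  rw [center_zero] at hs
  have hi := h.index_div k
  have hg0 : 0 ≤ (I.gap k : ℝ) / n := by positivity
  have hg1 : (I.gap k : ℝ) / n + 1 / n ≤ 1 := by
    rw [← add_div, div_le_one hn']; exact_mod_cast (I.gap k).2
  rcases I.turn_or_through h.legs_pos h.turn_last hk with ⟨-, -, hc, hg⟩ | ⟨j, rfl, h1, h2, h3⟩
  · have hg' : 1 / (n : ℝ) ≤ (I.gap k : ℝ) / n := by
      have : (1 : ℝ) ≤ (I.gap k : ℕ) := by exact_mod_cast hg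
      gcongr
    rw [hc, hi] at hs
    constructor <;> linarith
  · have hj : j + 1 < L := by
      rcases hk.eq_or_lt with rfl | hlt
      · exact absurd h3 h.turn_last
      · exact hlt
    rcases h.normal_of_through hj h3 with ⟨hc, hneg⟩ | ⟨hc, hpos⟩
    · rw [hc] at hs hneg
      push_cast at hs hneg
      rw [add_div, hi] at hs hneg
      constructor <;> linarith
    · rw [hc, hi] at hs hpos
      constructor <;> linarith

theorem vertical_pos_of_turn (h : I.IsBilliardPolygon r L p) {k : ℕ} (hk : k ≤ L)
    (h₁ : I.row (prevIndex k) = I.row k + verticalStep (I.up k))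
    (h₂ : I.row (nextIndex L k) = I.row k + verticalStep (I.up k)) :
    0 < (verticalStep (I.up k) : ℝ) * (p k 1 - I.row k) := by
  obtain ⟨κ, hκ, hnormal⟩ := h.exists_normal hk
  have h3 := I.row_sub_eq_or (k := k) h.legs_pos
  rw [← center_one]
  refine normal_vertical_pos hκ hnormal (h.vertical_distance h3.1 _ ?_)
    (h.vertical_distance h3.2 _ ?_)
  · rw [h₁]; push_cast; rfl
  · rw [h₂]; push_cast; rfl

/-- If a leg crosses the row of the obstacle where it starts or ends, it does so in the gap which
the itinerary prescribes. -/
theorem crossing_mem_gap (h : I.IsBilliardPolygon r L p) {k q : ℕ} (hk : k ≤ L)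
    (hq : q = prevIndex k ∨ q = nextIndex L k)
    (hside : (I.row q = I.row k + 1 ∧ p k 1 < I.row k) ∨
      (I.row q = I.row k - 1 ∧ (I.row k : ℝ) ≤ p k 1))
    {z : Plane} (hz : z ∈ segment ℝ (p k) (p q)) (hz1 : z 1 = I.row k) :
    z 0 ∈ Set.Icc ((I.tile k : ℝ) + (I.gap k : ℝ) / n + r)
      (I.tile k + ((I.gap k : ℝ) + 1) / n - r) := by
  have hn0 : 0 < n := zero_lt_two.trans_le h.two_le
  obtain ⟨hrn, hr1⟩ := small_radius hn0 h.radius_le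
  have hr0 := h.radius_pos
  have hi := h.index_div k
  rcases I.turn_or_through h.legs_pos h.turn_last hk with ⟨ha, hb, -, -⟩ | ⟨j, rfl, h1, h2, h3⟩
  · -- where the orbit turns back, it does not cross the row
    exfalso
    have hpos := h.vertical_pos_of_turn hk ha hb
    have hrow : I.row q = I.row k + verticalStep (I.up k) := by
      rcases hq with rfl | rfl <;> assumption
    rcases hside with ⟨e, hlt⟩ | ⟨e, hle⟩
    · have e' : verticalStep (I.up k) = 1 := by omega
      rw [e'] at hpos
      push_cast at hpos; linarith
    · have e' : verticalStep (I.up k) = -1 := by omega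
      rw [e'] at hpos
      push_cast at hpos; linarith
  · have hj : j + 1 < L := by
      rcases hk.eq_or_lt with rfl | hlt
      · exact absurd h3 h.turn_last
      · exact hlt
    have hrow : I.row q - I.row (j + 1) = 1 ∨ I.row q - I.row (j + 1) = -1 := by
      rcases hside with ⟨e, -⟩ | ⟨e, -⟩ <;> omega
    have hcol : |I.column q - I.column (j + 1)| ≤ 2 * n := by
      rcases hq with e | e <;> rw [e]
      · exact I.column_prev_near (k := j + 1) h.two_le
      · exact I.column_next_near (k := j + 1) h.two_le h.legs_pos
    have hcol' : |(I.column q : ℝ) / n - (I.column (j + 1) : ℝ) / n| ≤ 2 :=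
      abs_div_sub_div_le_two hn0 hcol
    obtain ⟨κ, hκ, hnormal⟩ := h.exists_normal hk
    have hin : 0 ≤ inner ℝ (p q - p (j + 1))
        (p (j + 1) - scattererCenter n (I.obstacle (j + 1))) := by
      obtain ⟨hA, hB⟩ := ne_of_notMem_segment (h.notMem_segment hk)
      rcases hq with e | e <;> rw [e]
      · exact inner_normal_nonneg hκ hA hB hnormal
      · exact inner_normal_nonneg hκ hB hA (by rw [hnormal, add_comm])
    have hslope : |p q 0 - p (j + 1) 0| ≤ 3 * |p q 1 - p (j + 1) 1| := by
      have a0 := abs_le.mp (abs_sub_le_of_mem_sphere (h.mem_sphere q) 0)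
      have a1 := abs_le.mp (abs_sub_le_of_mem_sphere (h.mem_sphere q) 1)
      have b0 := abs_le.mp (abs_sub_le_of_mem_sphere (h.mem_sphere (j + 1)) 0)
      have b1 := abs_le.mp (abs_sub_le_of_mem_sphere (h.mem_sphere (j + 1)) 1)
      rw [center_zero] at a0 b0
      rw [center_one] at a1 b1
      have hl : |p q 0 - p (j + 1) 0| ≤ 2 + 2 * r := by
        rw [abs_le] at hcol' ⊢
        constructor <;> linarith
      have hv : 1 - 2 * r ≤ |p q 1 - p (j + 1) 1| := by
        rcases hrow with e | e
        · have e' : (I.row q : ℝ) - I.row (j + 1) = 1 := by exact_mod_cast e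
          exact le_trans (by linarith) (le_abs_self _)
        · have e' : (I.row q : ℝ) - I.row (j + 1) = -1 := by exact_mod_cast e
          exact le_trans (by linarith) (neg_le_abs _)
      linarith
    have hc := row_crossing hr0 (h.mem_sphere (j + 1)) hin hslope hz
      (by rw [hz1, center_one])
    rw [center_zero] at hc
    rw [add_div, ← add_assoc, ← hi]
    rcases h.normal_of_through hj h3 with ⟨e, hneg⟩ | ⟨e, hpos⟩
    · have := hc.1 hneg
      rw [e] at this
      push_cast at this
      rw [add_div] at this
      constructor <;> linarith
    · have := hc.2 hpos
      rw [e] at this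
      constructor <;> linarith

end Itinerary.IsBilliardPolygon

/-! ### The word of the orbit of an itinerary -/

theorem prod_map_range_conj {G : Type*} [Group G] (b u : ℕ → G) (L : ℕ) :
    ((List.range L).map fun k => b k * u k * (b (k + 1))⁻¹).prod =
      b 0 * ((List.range L).map u).prod * (b L)⁻¹ := by
  induction L with
  | zero => simp
  | succ L ih => 
    simp only [List.range_succ, List.map_append, List.prod_append, ih, List.map_cons,
      List.map_nil, List.prod_cons, List.prod_nil]
    group

namespace Itinerary

variable {n : ℕ} (I : Itinerary n)

/-- The word which the itinerary prescribes for the way from the tile that is entered after the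
`k`-th obstacle to the tile that is entered after the next obstacle. -/
def legWord (k : ℕ) : TableGroup n :=
  FreeGroup.of none ^ (I.tile (k + 1) - I.tile k) *
    if I.up (k + 1) = I.up k then FreeGroup.of (some (I.gap (k + 1))) ^ verticalStep (I.up k)
    else 1

/-- The word of the way from the point `x` on the boundary of the `k`-th obstacle into the tile
that is visited next: it is trivial unless `x` lies on the other side of the row of the obstacle. -/
noncomputable def exitWord (k : ℕ) (x : Plane) : TableGroup n :=
  if I.up k then if (I.row k : ℝ) ≤ x 1 then 1 else FreeGroup.of (some (I.gap k))
  else if (I.row k : ℝ) ≤ x 1 then (FreeGroup.of (some (I.gap k)))⁻¹ else 1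

namespace IsBilliardPolygon

variable {I} {r : ℝ} {L : ℕ} {p : ℕ → Plane}

theorem exitWord_of_turn (h : I.IsBilliardPolygon r L p) {k : ℕ} (hk : k ≤ L)
    (h₁ : I.row (prevIndex k) = I.row k + verticalStep (I.up k))
    (h₂ : I.row (nextIndex L k) = I.row k + verticalStep (I.up k)) :
    I.exitWord k (p k) = 1 := by
  have hpos := h.vertical_pos_of_turn hk h₁ h₂
  rw [exitWord]
  cases hu : I.up k <;> rw [hu] at hpos <;> simp only [verticalStep] at hpos ⊢ <;>
    simp at hpos ⊢ <;> linarith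

theorem segmentWord_leg (h : I.IsBilliardPolygon r L p) {k : ℕ} (hk : k < L) :
    SegmentWord n r (p k) (p (k + 1))
      (I.exitWord k (p k) * I.legWord k * (I.exitWord (k + 1) (p (k + 1)))⁻¹) := by
  have hn0 : 0 < n := zero_lt_two.trans_le h.two_le
  obtain ⟨hrn, hr1⟩ := small_radius hn0 h.radius_le
  have hr0 := h.radius_pos
  have hnext : nextIndex L k = k + 1 := by rw [nextIndex, if_neg hk.ne]
  have hprev : prevIndex (k + 1) = k := rfl
  have hv : ∀ q, |p q 1 - I.row q| < 1 / 2 := by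
    intro q
    have := abs_sub_le_of_mem_sphere (h.mem_sphere q) 1
    rw [center_one] at this
    linarith
  have hfree := fun z hz i => h.free_flight hk (z := z) hz i
  cases hu : I.up k with
  | true =>
    have hrow : I.row (k + 1) = I.row k + 1 := by rw [row_succ, hu]; rfl
    have hrow' : (I.row (k + 1) : ℝ) = I.row k + 1 := by rw [hrow]; push_cast; rfl
    have hw := segmentWord_of_upward hn0 (i := I.gap k) (i' := I.gap (k + 1)) (j := I.row k)
      (I.tile_step k) hfree hr0 (h.mem_tile hk.le) (h.mem_tile hk) (hv k) (hrow' ▸ hv (k + 1))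
      (fun hlt z hz hz1 => h.crossing_mem_gap hk.le (Or.inr hnext.symm)
        (Or.inl ⟨hrow, hlt⟩) hz hz1)
      (fun hle z hz hz1 => h.crossing_mem_gap (q := k) hk (Or.inl hprev.symm)
        (Or.inr ⟨by linarith, by rw [hrow']; exact hle⟩) (segment_symm ℝ (p k) _ ▸ hz)
        (by rw [hrow']; exact hz1))
    convert hw using 1
    rw [exitWord, exitWord, legWord, hu, hrow']
    cases hu' : I.up (k + 1) <;> by_cases h1 : (I.row k : ℝ) ≤ p k 1 <;>
      by_cases h2 : (I.row k : ℝ) + 1 ≤ p (k + 1) 1 <;>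
      simp [h1, h2, verticalStep, mul_assoc]
  | false =>
    have hrow : I.row k = I.row (k + 1) + 1 := by rw [row_succ, hu, verticalStep]; simp
    have hrow' : (I.row k : ℝ) = I.row (k + 1) + 1 := by rw [hrow]; push_cast; rfl
    have hw := segmentWord_of_upward hn0 (P := p (k + 1)) (Q := p k) (X := I.tile (k + 1))
      (Y := I.tile k) (i := I.gap (k + 1)) (i' := I.gap k) (j := I.row (k + 1))
      (by rw [abs_sub_comm]; exact I.tile_step k)
      (fun z hz => hfree z (openSegment_symm ℝ (p k) _ ▸ hz)) hr0 (h.mem_tile hk)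
      (h.mem_tile hk.le) (hv (k + 1)) (hrow' ▸ hv k)
      (fun hlt z hz hz1 => h.crossing_mem_gap (q := k) hk (Or.inl hprev.symm)
        (Or.inl ⟨hrow, hlt⟩) hz hz1)
      (fun hle z hz hz1 => h.crossing_mem_gap hk.le (Or.inr hnext.symm)
        (Or.inr ⟨by linarith, by rw [hrow']; exact hle⟩) (segment_symm ℝ (p k) _ ▸ hz)
        (by rw [hrow']; exact hz1))
    convert hw.reverse using 1
    have hz : I.tile k - I.tile (k + 1) = -(I.tile (k + 1) - I.tile k) := by ring
    rw [exitWord, exitWord, legWord, hu, hrow', hz]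
    generalize I.tile (k + 1) - I.tile k = u
    cases hu' : I.up (k + 1) <;> by_cases h1 : (I.row (k + 1) : ℝ) ≤ p (k + 1) 1 <;>
      by_cases h2 : (I.row (k + 1) : ℝ) + 1 ≤ p k 1 <;>
      simp [h1, h2, verticalStep, mul_assoc]

theorem point_ne_succ (h : I.IsBilliardPolygon r L p) (k : ℕ) : p k ≠ p (k + 1) := by
  intro e
  have hrow : I.row (k + 1) - I.row k = 1 ∨ I.row (k + 1) - I.row k = -1 := by
    rw [row_succ, add_sub_cancel_left]; exact verticalStep_eq_or _
  have hr1 := (small_radius (zero_lt_two.trans_le h.two_le) h.radius_le).2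
  apply notMem_ball_of_row hr1 h.mem_sphere hrow
  rw [← e]
  exact Metric.sphere_subset_closedBall (h.mem_sphere k)

/-- The billiard orbit segment with the vertices of a shortest polygon. -/
def toBilliardSegment (h : I.IsBilliardPolygon r L p) : BilliardSegment n r where
  legs := L
  obstacle := I.obstacle
  point := p
  collision k _ := h.mem_sphere k
  moving k _ := h.point_ne_succ k
  free_flight k hk _ hz i := h.free_flight hk hz i
  reflection k hk := by
    obtain ⟨κ, hκ, hnormal⟩ := h.exists_normal hk.le
    have hprev : prevIndex (k + 1) = k := rfl
    have hnext : nextIndex L (k + 1) = k + 2 := by rw [nextIndex, if_neg hk.ne]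
    rw [hprev, hnext] at hnormal
    exact reflection_of_bisector h.radius_pos (h.mem_sphere (k + 1)) (h.point_ne_succ k)
      (h.point_ne_succ (k + 1)) hnormal

theorem isAdmissible (h : I.IsBilliardPolygon r L p) : h.toBilliardSegment.IsAdmissible where
  ne k _ e := by
    have hrow : I.row k = I.row (k + 1) := congrArg Prod.snd e
    rw [row_succ] at hrow
    rcases verticalStep_eq_or (I.up k) with e | e <;> omega
  hull k _ i hi hi' := I.hull_disjoint h.two_le h.radius_pos h.radius_le k hi hi'
  turn k hk := by
    have hk' : k + 1 < L := hk
    have := I.turn_disjoint h.two_le h.radius_pos h.radius_le h.legs_pos h.turn_last hk'.le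
    rwa [nextIndex, if_neg hk'.ne] at this

theorem isShortest (h : I.IsBilliardPolygon r L p) : h.toBilliardSegment.IsShortest :=
  fun q hq => h.length_le q hq

theorem hasWord (h : I.IsBilliardPolygon r L p) :
    h.toBilliardSegment.HasWord ((List.range L).map I.legWord).prod := by
  refine ⟨fun k => I.exitWord k (p k) * I.legWord k * (I.exitWord (k + 1) (p (k + 1)))⁻¹,
    fun k hk => h.segmentWord_leg hk, ?_⟩
  have e := prod_map_range_conj (fun k => I.exitWord k (p k)) I.legWord L
  have h0 : I.exitWord 0 (p 0) = 1 := by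
    rcases I.turn_or_through h.legs_pos h.turn_last L.zero_le with ⟨h1, h2, -⟩ | ⟨j, hj, -⟩
    · exact h.exitWord_of_turn L.zero_le h1 h2
    · omega
  have hL : I.exitWord L (p L) = 1 := by
    rcases I.turn_or_through h.legs_pos h.turn_last le_rfl with ⟨h1, h2, -⟩ | ⟨j, rfl, -, -, hj⟩
    · exact h.exitWord_of_turn le_rfl h1 h2
    · exact absurd hj h.turn_last
  simp only [h0, hL, inv_one, one_mul, mul_one] at e
  exact e.symm

end IsBilliardPolygon

end Itinerary

/-! ### The itinerary of a word -/

/-- A state of the process that transforms an infinite word into an itinerary: the number of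
letters already realized, and the current tile column, gap, and vertical direction. -/
structure WordState (n : ℕ) where
  letters : ℕ
  tile : ℤ
  gap : Fin n
  up : Bool

namespace WordState

variable {n : ℕ}

/-- One leg of the itinerary that realizes the first `m` letters of `w`.  A letter `a` or `a⁻¹` is
realized by turning back near the vertical wall in the next tile.  A letter `b_i` or `b_i⁻¹` is
realized by passing through the gap, if the current tile is to be left in the current direction;
otherwise the orbit first turns back half-way between the current gap and the next one.  When
all letters are realized, the orbit turns back all the time within the last tile. -/
def next (hn : 2 ≤ n) (w : ℕ → Gen n × Bool) (m : ℕ) (s : WordState n) : WordState n :=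
  if s.letters < m then
    match w s.letters with
    | (none, true) => ⟨s.letters + 1, s.tile + 1, ⟨1, by omega⟩, !s.up⟩
    | (none, false) => ⟨s.letters + 1, s.tile - 1, ⟨n - 1, by omega⟩, !s.up⟩
    | (some i, σ) =>
      if s.up = σ then ⟨s.letters + 1, s.tile, i, s.up⟩
      else ⟨s.letters, s.tile, ⟨max 1 ((s.gap + i) / 2), by omega⟩, !s.up⟩
  else ⟨s.letters, s.tile, ⟨1, by omega⟩, !s.up⟩

variable (hn : 2 ≤ n) (w : ℕ → Gen n × Bool) (m : ℕ) (s : WordState n)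

theorem next_of_le (h : m ≤ s.letters) :
    next hn w m s = ⟨s.letters, s.tile, ⟨1, by omega⟩, !s.up⟩ := by
  rw [next, if_neg h.not_gt]

theorem next_right (h : s.letters < m) (hw : w s.letters = (none, true)) :
    next hn w m s = ⟨s.letters + 1, s.tile + 1, ⟨1, by omega⟩, !s.up⟩ := by
  rw [next, if_pos h, hw]

theorem next_left (h : s.letters < m) (hw : w s.letters = (none, false)) :
    next hn w m s = ⟨s.letters + 1, s.tile - 1, ⟨n - 1, by omega⟩, !s.up⟩ := by
  rw [next, if_pos h, hw]

theorem next_through (h : s.letters < m) {i : Fin n} (hw : w s.letters = (some i, s.up)) :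
    next hn w m s = ⟨s.letters + 1, s.tile, i, s.up⟩ := by
  rw [next, if_pos h, hw]; simp

theorem next_midway (h : s.letters < m) {i : Fin n} (hw : w s.letters = (some i, !s.up)) :
    next hn w m s = ⟨s.letters, s.tile, ⟨max 1 ((s.gap + i) / 2), by omega⟩, !s.up⟩ := by
  rw [next, if_pos h, hw]; simp

theorem next_cases : m ≤ s.letters ∨ (s.letters < m ∧ (w s.letters = (none, true) ∨
    w s.letters = (none, false) ∨ (∃ i, w s.letters = (some i, s.up)) ∨
      ∃ i, w s.letters = (some i, !s.up))) := by
  rcases le_or_gt m s.letters with h | h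
  · exact Or.inl h
  · refine Or.inr ⟨h, ?_⟩
    obtain ⟨x, σ⟩ := w s.letters
    cases x <;> cases σ <;> cases s.up <;> simp

theorem abs_next_tile_sub_le : |(next hn w m s).tile - s.tile| ≤ 1 := by
  rcases next_cases w m s with h | ⟨h, h' | h' | ⟨i, h'⟩ | ⟨i, h'⟩⟩
  · rw [next_of_le hn w m s h]; simp
  · rw [next_right hn w m s h h']; simp
  · rw [next_left hn w m s h h']; simp
  · rw [next_through hn w m s h h']; simp
  · rw [next_midway hn w m s h h']; simp

theorem abs_next_index_sub_le :
    |((next hn w m s).tile * n + (next hn w m s).gap) - (s.tile * n + s.gap)| ≤ (n : ℤ) + 1 := by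
  have h0 := s.gap.2
  rcases next_cases w m s with h | ⟨h, h' | h' | ⟨i, h'⟩ | ⟨i, h'⟩⟩
  · rw [next_of_le hn w m s h, abs_le]; simp only; constructor <;> omega
  · rw [next_right hn w m s h h', abs_le, add_mul]; simp only
    constructor <;> push_cast <;> omega
  · rw [next_left hn w m s h h', abs_le, sub_mul]; simp only
    constructor <;> omega
  · have := i.2
    rw [next_through hn w m s h h', abs_le]; simp only; constructor <;> omega
  · have := i.2
    rw [next_midway hn w m s h h', abs_le]; simp only; constructor <;> push_cast <;> omega

theorem next_gap_pos (hup : (next hn w m s).up ≠ s.up) : 0 < ((next hn w m s).gap : ℕ) := by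
  rcases next_cases w m s with h | ⟨h, h' | h' | ⟨i, h'⟩ | ⟨i, h'⟩⟩
  · rw [next_of_le hn w m s h]; simp
  · rw [next_right hn w m s h h']; simp
  · rw [next_left hn w m s h h']; simp only; omega
  · rw [next_through hn w m s h h'] at hup; simp at hup
  · rw [next_midway hn w m s h h']; simp only; omega

theorem next_word : (s.letters < m ∧ (next hn w m s).letters = s.letters + 1 ∧
      FreeGroup.of none ^ ((next hn w m s).tile - s.tile) *
        (if (next hn w m s).up = s.up then
          FreeGroup.of (some (next hn w m s).gap) ^ verticalStep s.up else 1) =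
        FreeGroup.mk [w s.letters]) ∨
    ((next hn w m s).letters = s.letters ∧
      FreeGroup.of none ^ ((next hn w m s).tile - s.tile) *
        (if (next hn w m s).up = s.up then
          FreeGroup.of (some (next hn w m s).gap) ^ verticalStep s.up else 1) =
        (1 : TableGroup n)) := by
  rcases next_cases w m s with h | ⟨h, h' | h' | ⟨i, h'⟩ | ⟨i, h'⟩⟩
  · right; rw [next_of_le hn w m s h]; simp
  · left; rw [next_right hn w m s h h', h']; simp [h]; rfl
  · left; rw [next_left hn w m s h h', h']; simp [h]; rfl
  · left; rw [next_through hn w m s h h', h']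
    cases s.up <;> simp [h, verticalStep] <;> rfl
  · right; rw [next_midway hn w m s h h']; simp

/-- The sequence of the states. -/
def states : ℕ → WordState n
  | 0 => ⟨0, 0, ⟨1, by omega⟩, true⟩
  | k + 1 => next hn w m (states k)

end WordState

open WordState in
/-- The itinerary that realizes the first `m` letters of the word `w` and then stays in the last
tile. -/
def wordItinerary {n : ℕ} (hn : 2 ≤ n) (w : ℕ → Gen n × Bool) (m : ℕ) : Itinerary n where
  tile k := (states hn w m k).tile
  gap k := (states hn w m k).gap
  up k := (states hn w m k).up
  tile_step k := abs_next_tile_sub_le hn w m _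
  near k := abs_next_index_sub_le hn w m _
  gap_zero := by change 0 < 1; exact one_pos
  gap_turn k hk := next_gap_pos hn w m _ hk

section wordItinerary

open WordState

variable {n : ℕ} (hn : 2 ≤ n) (w : ℕ → Gen n × Bool) (m : ℕ)

theorem prod_legWord_wordItinerary (k : ℕ) :
    ((List.range k).map (wordItinerary hn w m).legWord).prod =
      FreeGroup.mk ((List.range (states hn w m k).letters).map w) := by
  induction k with
  | zero => rfl
  | succ k ih =>
    rw [List.range_succ, List.map_append, List.prod_append, ih]
    simp only [List.map_cons, List.map_nil, List.prod_cons, List.prod_nil, mul_one]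
    have e : (states hn w m (k + 1)) = next hn w m (states hn w m k) := rfl
    rcases next_word hn w m (states hn w m k) with ⟨-, h1, h2⟩ | ⟨h1, h2⟩
    · rw [e, h1, List.range_succ, List.map_append, ← FreeGroup.mul_mk]
      exact congrArg _ h2
    · rw [e, h1]
      exact (congrArg _ h2).trans (mul_one _)

theorem dist_center_succ (I : Itinerary n) (k : ℕ) :
    dist (scattererCenter n (I.obstacle k)) (scattererCenter n (I.obstacle (k + 1))) =
      √(((I.column (k + 1) - I.column k : ℤ) / n : ℝ) ^ 2 + 1) := by
  rw [Plane.dist_eq, I.center_zero, I.center_zero, I.center_one, I.center_one, I.row_succ]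
  have : ((I.row k : ℝ) - (I.row k + verticalStep (I.up k) : ℤ)) ^ 2 = 1 := by
    rcases verticalStep_eq_or (I.up k) with e | e <;> rw [e] <;> push_cast <;> ring
  rw [this]
  congr 2
  push_cast; ring

theorem sqrt_sq_add_one_le (hn : 2 ≤ n) {d : ℤ} (h : |d| ≤ (n : ℤ) + 2) :
    √((d / n : ℝ) ^ 2 + 1) ≤ √5 + 6 / n := by
  have hn' : (2 : ℝ) ≤ n := by exact_mod_cast hn
  have hd : |(d : ℝ) / n| ≤ 1 + 2 / n := by
    rw [abs_div, Nat.abs_cast, div_le_iff₀ (by linarith)]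
    have : |(d : ℝ)| ≤ n + 2 := by exact_mod_cast h
    refine this.trans_eq ?_
    field_simp
  have hx : (1 : ℝ) / n ≤ 1 / 2 := by gcongr
  have hx0 : 0 < (1 : ℝ) / n := by positivity
  have e2 : (2 : ℝ) / n = 2 * (1 / n) := by ring
  have e6 : (6 : ℝ) / n = 6 * (1 / n) := by ring
  rw [e2] at hd
  rw [e6]
  set x := (1 : ℝ) / n
  have h5 : √5 ^ 2 = 5 := Real.sq_sqrt (by norm_num)
  have h50 := Real.sqrt_nonneg 5
  rw [Real.sqrt_le_left (by positivity)]
  have : ((d : ℝ) / n) ^ 2 ≤ (1 + 2 * x) ^ 2 := sq_le_sq' (by linarith [(abs_le.mp hd).1])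
    (abs_le.mp hd).2
  nlinarith [mul_nonneg h50 hx0.le]

theorem sqrt_sq_add_one_le_half (hn : 2 ≤ n) {d : ℤ} (h : 2 * |d| ≤ (n : ℤ) + 4) :
    √((d / n : ℝ) ^ 2 + 1) ≤ (√5 + 6 / n) / 2 := by
  have hn' : (2 : ℝ) ≤ n := by exact_mod_cast hn
  have hd : |(d : ℝ) / n| ≤ 1 / 2 + 2 / n := by
    rw [abs_div, Nat.abs_cast, div_le_iff₀ (by linarith)]
    have : 2 * |(d : ℝ)| ≤ n + 4 := by exact_mod_cast h
    have e : (1 / 2 + 2 / n : ℝ) * n = n / 2 + 2 := by field_simp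
    rw [e]; linarith
  have hx0 : 0 < (1 : ℝ) / n := by positivity
  have e2 : (2 : ℝ) / n = 2 * (1 / n) := by ring
  have e6 : (6 : ℝ) / n = 6 * (1 / n) := by ring
  rw [e2] at hd
  rw [e6]
  set x := (1 : ℝ) / n
  have h5 : √5 ^ 2 = 5 := Real.sq_sqrt (by norm_num)
  have h50 : 2 ≤ √5 := Real.le_sqrt_of_sq_le (by norm_num)
  rw [Real.sqrt_le_left (by positivity)]
  have : ((d : ℝ) / n) ^ 2 ≤ (1 / 2 + 2 * x) ^ 2 := sq_le_sq' (by linarith [(abs_le.mp hd).1])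
    (abs_le.mp hd).2
  nlinarith [mul_le_mul_of_nonneg_right h50 hx0.le]

/-- The total length of the first `L` legs between the centres of the obstacles. -/
noncomputable def Itinerary.centerLength (I : Itinerary n) (L : ℕ) : ℝ :=
  polygonLength L fun k => scattererCenter n (I.obstacle k)

theorem Itinerary.centerLength_succ (I : Itinerary n) (L : ℕ) :
    I.centerLength (L + 1) = I.centerLength L +
      dist (scattererCenter n (I.obstacle L)) (scattererCenter n (I.obstacle (L + 1))) :=
  Finset.sum_range_succ _ _

theorem dist_center_le (hn : 2 ≤ n) (I : Itinerary n) (k : ℕ) :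
    dist (scattererCenter n (I.obstacle k)) (scattererCenter n (I.obstacle (k + 1))) ≤
      √5 + 6 / n := by
  rw [dist_center_succ]
  exact sqrt_sq_add_one_le hn (I.column_near k)

/-- A leg within one tile column between gaps at a distance of about half of the width. -/
theorem dist_center_le_half (hn : 2 ≤ n) (I : Itinerary n) (k : ℕ)
    (h : I.tile (k + 1) = I.tile k)
    (h' : 2 * |(I.gap (k + 1) : ℤ) - I.gap k| ≤ (n : ℤ) + 2) :
    dist (scattererCenter n (I.obstacle k)) (scattererCenter n (I.obstacle (k + 1))) ≤
      (√5 + 6 / n) / 2 := by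
  rw [dist_center_succ]
  apply sqrt_sq_add_one_le_half hn
  have h0 := I.column_eq_or k
  have h1 := I.column_eq_or (k + 1)
  simp only [Itinerary.index, h] at h0 h1
  generalize I.tile k * (n : ℤ) = t at *
  have e : ∀ z : ℤ, 2 * |z| ≤ (n : ℤ) + 4 ↔ 2 * z ≤ n + 4 ∧ -(2 * z) ≤ n + 4 := by
    intro z; constructor
    · intro hz; constructor <;> cases abs_cases z <;> omega
    · intro hz; cases abs_cases z <;> omega
  rw [e]
  have := le_abs_self ((I.gap (k + 1) : ℤ) - I.gap k)
  have := neg_le_abs ((I.gap (k + 1) : ℤ) - I.gap k)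
  omega

/-- Each letter is realized within a length of `√5`, up to an error of order `1 / n`.  The worst
case are letters `b_i` and `b_j⁻¹` in succession, for gaps at the two ends of a tile. -/
theorem exists_letters_eq (t : ℕ) (ht : t ≤ m) :
    ∃ k, (states hn w m k).letters = t ∧
      (wordItinerary hn w m).centerLength k ≤ (√5 + 6 / n) * t := by
  induction t with
  | zero => exact ⟨0, rfl, by simp [Itinerary.centerLength, polygonLength]⟩
  | succ t ih =>
    obtain ⟨k, hk, hlen⟩ := ih (by omega)
    have hone : ∀ k, (states hn w m (k + 1)).letters = t + 1 →
        (wordItinerary hn w m).centerLength k ≤ (√5 + 6 / n) * t →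
        ∃ k, (states hn w m k).letters = t + 1 ∧
          (wordItinerary hn w m).centerLength k ≤ (√5 + 6 / n) * (t + 1 : ℕ) := by
      intro k hk hlen
      refine ⟨k + 1, hk, ?_⟩
      rw [Itinerary.centerLength_succ]
      have := dist_center_le hn (wordItinerary hn w m) k
      push_cast; linarith
    have e : states hn w m (k + 1) = next hn w m (states hn w m k) := rfl
    have hlt : (states hn w m k).letters < m := by omega
    rcases next_cases w m (states hn w m k) with h | ⟨h, h' | h' | ⟨i, h'⟩ | ⟨i, h'⟩⟩
    · omega
    · exact hone k (by rw [e, next_right hn w m _ h h', hk]) hlen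
    · exact hone k (by rw [e, next_left hn w m _ h h', hk]) hlen
    · exact hone k (by rw [e, next_through hn w m _ h h', hk]) hlen
    · have e1 := next_midway hn w m _ h h'
      rw [← e] at e1
      have h1 : (states hn w m (k + 1)).letters = t := by rw [e1]; exact hk
      have h1' : w (states hn w m (k + 1)).letters = (some i, (states hn w m (k + 1)).up) := by
        rw [h1, ← hk, h', e1]
      have e2 : states hn w m (k + 2) = next hn w m (states hn w m (k + 1)) := rfl
      rw [next_through hn w m _ (by omega) h1'] at e2
      refine ⟨k + 2, by rw [e2, h1], ?_⟩
      rw [show k + 2 = k + 1 + 1 from rfl, Itinerary.centerLength_succ,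
        Itinerary.centerLength_succ]
      have hg : ((states hn w m (k + 1)).gap : ℕ) =
          max 1 ((((states hn w m k).gap : ℕ) + (i : ℕ)) / 2) := by
        rw [e1]
      have hg2 : (states hn w m (k + 2)).gap = i := by rw [e2]
      have hi := i.2
      have hg0 := (states hn w m k).gap.2
      have l1 := dist_center_le_half hn (wordItinerary hn w m) k
        (by change (states hn w m (k + 1)).tile = (states hn w m k).tile; rw [e1])
        (by
          change 2 * |((states hn w m (k + 1)).gap : ℤ) - ((states hn w m k).gap : ℕ)| ≤ _
          cases abs_cases (((states hn w m (k + 1)).gap : ℤ) - ((states hn w m k).gap : ℕ)) <;> omega)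
      have l2 := dist_center_le_half hn (wordItinerary hn w m) (k + 1)
        (by change (states hn w m (k + 2)).tile = (states hn w m (k + 1)).tile; rw [e2])
        (by
          change 2 * |((states hn w m (k + 2)).gap : ℤ) - ((states hn w m (k + 1)).gap : ℕ)| ≤ _
          rw [hg2]
          cases abs_cases ((i : ℤ) - ((states hn w m (k + 1)).gap : ℕ)) <;> omega)
      push_cast
      linarith

theorem letters_eq_of_le {k l : ℕ} (hk : (states hn w m k).letters = m) (hl : k ≤ l) :
    (states hn w m l).letters = m := by
  induction l, hl using Nat.le_induction with
  | base => exact hk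
  | succ l _ ih =>
    have e : states hn w m (l + 1) = next hn w m (states hn w m l) := rfl
    rw [e, next_of_le hn w m _ ih.ge]; exact ih

theorem up_succ_ne {k : ℕ} (hk : (states hn w m k).letters = m) :
    (wordItinerary hn w m).up (k + 1) ≠ (wordItinerary hn w m).up k := by
  change (next hn w m (states hn w m k)).up ≠ (states hn w m k).up
  rw [next_of_le hn w m _ hk.ge]; simp

end wordItinerary

/-! ### Adjusting the time span -/

section Tuning

variable {n : ℕ} {r : ℝ} {I : Itinerary n}

theorem IsShortestPolygon.length_le_centerLength {L : ℕ} {p : ℕ → Plane} (hr0 : 0 < r)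
    (hp : IsShortestPolygon n r I.obstacle L p) : polygonLength L p ≤ I.centerLength L := by
  obtain ⟨v, hv⟩ : (Metric.sphere (0 : Plane) r).Nonempty :=
    NormedSpace.sphere_nonempty.mpr hr0.le
  have h := hp.length_le (fun k => scattererCenter n (I.obstacle k) + v) (by
    intro k _
    rw [mem_sphere_iff_norm, add_sub_cancel_left]
    exact mem_sphere_zero_iff_norm.mp hv)
  refine h.trans_eq ?_
  simp [polygonLength, Itinerary.centerLength]

theorem dist_point_le (hn : 2 ≤ n) (hr : 100 * n * r ≤ 1) {p : ℕ → Plane}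
    (hp : ∀ k, p k ∈ Metric.sphere (scattererCenter n (I.obstacle k)) r) (k : ℕ) :
    dist (p k) (p (k + 1)) ≤ 6 := by
  have hr1 := (small_radius (zero_lt_two.trans_le hn) hr).2
  have h1 := dist_center_le hn I k
  have h2 : dist (p k) (scattererCenter n (I.obstacle k)) = r := hp k
  have h3 : dist (scattererCenter n (I.obstacle (k + 1))) (p (k + 1)) = r := by
    rw [dist_comm]; exact hp (k + 1)
  have h4 := dist_triangle4 (p k) (scattererCenter n (I.obstacle k))
    (scattererCenter n (I.obstacle (k + 1))) (p (k + 1))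
  have h5 : √5 ≤ 5 / 2 := Real.sqrt_le_iff.mpr ⟨by norm_num, by norm_num⟩
  have hn' : (2 : ℝ) ≤ n := by exact_mod_cast hn
  have h6 : (6 : ℝ) / n ≤ 3 := by
    rw [div_le_iff₀ (by linarith)]; linarith
  linarith

theorem half_le_dist_point (hn : 2 ≤ n) (hr : 100 * n * r ≤ 1) {p : ℕ → Plane}
    (hp : ∀ k, p k ∈ Metric.sphere (scattererCenter n (I.obstacle k)) r) (k : ℕ) :
    1 / 2 ≤ dist (p k) (p (k + 1)) := by
  have hr1 := (small_radius (zero_lt_two.trans_le hn) hr).2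
  have h1 := abs_le.mp (abs_sub_le_of_mem_sphere (hp k) 1)
  have h2 := abs_le.mp (abs_sub_le_of_mem_sphere (hp (k + 1)) 1)
  rw [I.center_one] at h1 h2
  rw [I.row_succ] at h2
  have h3 : |p k 1 - p (k + 1) 1| ≤ dist (p k) (p (k + 1)) := by
    rw [_root_.dist_eq_norm]; exact Plane.abs_apply_le (p k - p (k + 1)) 1
  have h4 := (abs_le.mp h3).1
  have h5 := (abs_le.mp h3).2
  rcases verticalStep_eq_or (I.up k) with e | e <;> rw [e] at h2 <;> push_cast at h2 <;> linarith

theorem half_mul_le_polygonLength (hn : 2 ≤ n) (hr : 100 * n * r ≤ 1) {p : ℕ → Plane}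
    (hp : ∀ k, p k ∈ Metric.sphere (scattererCenter n (I.obstacle k)) r) (L : ℕ) :
    (L : ℝ) / 2 ≤ polygonLength L p := by
  have := Finset.card_nsmul_le_sum (Finset.range L) (fun k => dist (p k) (p (k + 1))) (1 / 2)
    (fun k _ => half_le_dist_point hn hr hp k)
  rw [Finset.card_range, nsmul_eq_mul] at this
  rw [polygonLength]
  linarith

/-- By prolonging a shortest polygon, any length from the length of a given one on is attained up to
a bounded error. -/
theorem exists_shortest_length_near (hn : 2 ≤ n) (hr0 : 0 < r) (hr : 100 * n * r ≤ 1)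
    (I : Itinerary n) (L₀ : ℕ) {τ : ℝ} (hτ : I.centerLength L₀ ≤ τ) :
    ∃ L p, L₀ < L ∧ IsShortestPolygon n r I.obstacle L p ∧ τ ≤ polygonLength L p ∧
      polygonLength L p ≤ τ + 6 := by
  choose p hp using exists_isShortestPolygon n hr0 I.obstacle
  have hstep : ∀ L, polygonLength (L + 1) (p (L + 1)) ≤ polygonLength L (p L) + 6 := by
    intro L
    have h1 := (hp (L + 1)).length_le (p L) (fun k _ => (hp L).mem_sphere k)
    have h2 : polygonLength (L + 1) (p L) = polygonLength L (p L) +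
        dist (p L L) (p L (L + 1)) := Finset.sum_range_succ _ _
    have h3 := dist_point_le hn hr (hp L).mem_sphere L
    linarith
  have hex : ∃ L, L₀ < L ∧ τ ≤ polygonLength L (p L) := by
    obtain ⟨N, hN⟩ := exists_nat_gt (2 * τ)
    refine ⟨max (L₀ + 1) N, by omega, ?_⟩
    have h1 := half_mul_le_polygonLength hn hr (hp (max (L₀ + 1) N)).mem_sphere (max (L₀ + 1) N)
    have h2 : (N : ℝ) ≤ (max (L₀ + 1) N : ℕ) := by exact_mod_cast le_max_right _ _
    linarith
  classical
  set L := Nat.find hex with hL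
  obtain ⟨h1, h2⟩ := Nat.find_spec hex
  refine ⟨L, p L, h1, hp L, h2, ?_⟩
  obtain ⟨K, hK⟩ : ∃ K, L = K + 1 := Nat.exists_eq_add_of_le' (by omega : 1 ≤ L)
  have hmin := Nat.find_min hex (m := K) (by omega)
  have hs := hstep K
  rw [hK]
  by_cases hK0 : L₀ < K
  · have : polygonLength K (p K) < τ := by
      by_contra hcon
      exact hmin ⟨hK0, not_lt.mp hcon⟩
    linarith
  · have hKeq : K = L₀ := by omega
    have := (hp K).length_le_centerLength hr0
    rw [hKeq] at this hs ⊢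
    linarith

end Tuning

/-- The product of the first `m` letters of a word is realized by an admissible shortest orbit segment with a
prescribed time span, up to a bounded error. -/
theorem exists_billiardSegment_of_word {n : ℕ} (hn : 2 ≤ n) {r : ℝ} (hr0 : 0 < r)
    (hr : 100 * n * r ≤ 1) (w : ℕ → Gen n × Bool) (m : ℕ) {τ : ℝ}
    (hτ : (√5 + 6 / n) * m ≤ τ) :
    ∃ γ : BilliardSegment n r, γ.IsAdmissible ∧ γ.IsShortest ∧
      γ.HasWord (FreeGroup.mk ((List.range m).map w)) ∧ τ ≤ γ.time ∧ γ.time ≤ τ + 6 := by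
  obtain ⟨L₀, hL₀, hlen⟩ := exists_letters_eq hn w m m le_rfl
  obtain ⟨L, p, hL, hp, h1, h2⟩ := exists_shortest_length_near hn hr0 hr (wordItinerary hn w m) L₀
    (hlen.trans hτ)
  obtain ⟨K, rfl⟩ : ∃ K, L = K + 1 := Nat.exists_eq_add_of_le' (by omega : 1 ≤ L)
  have h : (wordItinerary hn w m).IsBilliardPolygon r (K + 1) p :=
    { toIsShortestPolygon := hp
      two_le := hn
      radius_pos := hr0
      radius_le := hr
      legs_pos := K.succ_pos
      turn_last := up_succ_ne hn w m (letters_eq_of_le hn w m hL₀ (by omega)) }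
  refine ⟨h.toBilliardSegment, h.isAdmissible, h.isShortest, ?_, h1, h2⟩
  have hw := h.hasWord
  rwa [prod_legWord_wordItinerary, letters_eq_of_le hn w m hL₀ hL.le] at hw

/-! ### Ends and speeds -/

theorem Ends.toWord_mk {n : ℕ} (e : Ends n) (m : ℕ) :
    (FreeGroup.mk ((List.range m).map e.1)).toWord = (List.range m).map e.1 := by
  rw [FreeGroup.toWord_mk]
  apply FreeGroup.IsReduced.reduce_eq
  rw [FreeGroup.IsReduced, List.isChain_map, List.isChain_range]
  intro k _ h
  have hk := e.2 k
  by_contra hne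
  apply hk
  refine Prod.ext h.symm ?_
  revert hne
  cases (e.1 k).2 <;> cases (e.1 (k + 1)).2 <;> simp

theorem admissiblyRealized_of_le {n : ℕ} (hn : 2 ≤ n) {r : ℝ} (hr0 : 0 < r)
    (hr : 100 * n * r ≤ 1) (e : Ends n) (s : ℝ≥0) (hs : (√5 + 6 / n) * s ≤ 1) :
    AdmissiblyRealized n r s e := by
  have hn' : (2 : ℝ) ≤ n := by exact_mod_cast hn
  have h5 : √5 ≤ 3 := Real.sqrt_le_iff.mpr ⟨by norm_num, by norm_num⟩
  have h51 : 1 ≤ √5 := Real.one_le_sqrt.mpr (by norm_num)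
  have h6 : (6 : ℝ) / n ≤ 3 := by
    rw [div_le_iff₀ (by linarith)]; linarith
  have h60 : (0 : ℝ) ≤ 6 / n := by positivity
  -- positive speeds approaching `s`
  set σ : ℕ → ℝ := fun m => max (s : ℝ) (1 / ((m : ℝ) + 6)) with hσ
  have hσ0 : ∀ m, 0 < σ m := fun m => lt_max_of_lt_right (by positivity)
  have hσ1 : ∀ m, (√5 + 6 / n) * σ m ≤ 1 := by
    intro m
    rcases le_total (s : ℝ) (1 / ((m : ℝ) + 6)) with h | h
    · simp only [hσ, max_eq_right h]
      rw [mul_one_div, div_le_one (by positivity)]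
      have : (0 : ℝ) ≤ m := m.cast_nonneg
      linarith
    · simp only [hσ, max_eq_left h]; exact hs
  have hσlim : Tendsto σ atTop (𝓝 (s : ℝ)) := by
    have h0 : Tendsto (fun m : ℕ => 1 / ((m : ℝ) + 6)) atTop (𝓝 0) := by
      refine tendsto_const_nhds.div_atTop ?_
      exact tendsto_atTop_add_const_right _ _ tendsto_natCast_atTop_atTop
    have := (tendsto_const_nhds (x := (s : ℝ))).max h0
    rwa [max_eq_left (NNReal.coe_nonneg s)] at this
  have hex : ∀ m : ℕ, ∃ γ : BilliardSegment n r, γ.IsAdmissible ∧ γ.IsShortest ∧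
      γ.HasWord (FreeGroup.mk ((List.range m).map e.1)) ∧ m / σ m ≤ γ.time ∧
        γ.time ≤ m / σ m + 6 := by
    intro m
    apply exists_billiardSegment_of_word hn hr0 hr
    rw [le_div_iff₀ (hσ0 m)]
    calc (√5 + 6 / n) * m * σ m = ((√5 + 6 / n) * σ m) * m := by ring
      _ ≤ 1 * m := by gcongr; exact hσ1 m
      _ = m := one_mul _
  choose γ hadm hshort hword hlow hupp using hex
  have hσle : ∀ m, σ m ≤ 1 := by
    intro m
    have := hσ1 m
    nlinarith [hσ0 m]
  have htime : Tendsto (fun m => (γ m).time) atTop atTop := by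
    refine tendsto_atTop_mono (fun m => ?_) (tendsto_natCast_atTop_atTop (R := ℝ))
    refine le_trans ?_ (hlow m)
    rw [le_div_iff₀ (hσ0 m)]
    exact mul_le_of_le_one_right m.cast_nonneg (hσle m)
  refine ⟨γ, fun m => FreeGroup.mk ((List.range m).map e.1), hadm, hshort, hword, htime, ?_, ?_⟩
  · have hnorm : ∀ m, ((FreeGroup.mk ((List.range m).map e.1)).norm : ℝ) = m := by
      intro m
      rw [FreeGroup.norm, Ends.toWord_mk]; simp
    simp only [hnorm]
    have hdiff : Tendsto (fun m : ℕ => σ m - m / (γ m).time) atTop (𝓝 0) := by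
      have h0 : Tendsto (fun m => 6 / (γ m).time) atTop (𝓝 0) :=
        tendsto_const_nhds.div_atTop htime
      refine squeeze_zero' ?_ ?_ h0
      · filter_upwards [htime.eventually_gt_atTop 0] with m hm
        have := hlow m
        rw [div_le_iff₀ (hσ0 m)] at this
        rw [sub_nonneg, div_le_iff₀ hm]
        linarith
      · filter_upwards [htime.eventually_gt_atTop 0] with m hm
        have h1 := mul_le_mul_of_nonneg_right (hupp m) (hσ0 m).le
        rw [add_mul, div_mul_cancel₀ _ (hσ0 m).ne'] at h1
        have h2 := hσle m
        rw [le_div_iff₀ hm, sub_mul, div_mul_cancel₀ _ hm.ne']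
        nlinarith
    have := hσlim.sub hdiff
    simpa using this
  · intro k
    filter_upwards [eventually_ge_atTop k] with m hm
    rw [Ends.toWord_mk]
    apply List.IsPrefix.map
    rw [List.prefix_iff_eq_take]
    simp [List.take_range, hm]

theorem theorem2p2 :
    ∃ C c : ℝ, 0 < C ∧ 0 < c ∧ c < 1 / 2 ∧
      ∀ n : ℕ, 1 ≤ n → ∀ r : ℝ, 0 < r → r ≤ c / (n : ℝ) →
        vertexBall n (1 / √5 - C / (n : ℝ)) ⊆ admissibleRotationSet n r ∧
        ∀ (e : Ends n) (s : ℝ≥0), (s : ℝ) ≤ 1 / √5 - C / (n : ℝ) →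
          AdmissiblyRealized n r s e := by
  have key : ∀ n : ℕ, 1 ≤ n → ∀ r : ℝ, 0 < r → r ≤ 1 / 100 / (n : ℝ) →
      ∀ (e : Ends n) (s : ℝ≥0), (s : ℝ) ≤ 1 / √5 - 2 / (n : ℝ) → AdmissiblyRealized n r s e := by
    intro n hn1 r hr0 hr e s hs
    have hn' : (0 : ℝ) < n := by exact_mod_cast hn1
    have h5 : √5 ^ 2 = 5 := Real.sq_sqrt (by norm_num)
    have h52 : 2 ≤ √5 := Real.le_sqrt_of_sq_le (by norm_num)
    have h5i : 1 / √5 ≤ 1 / 2 := by gcongr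
    have hinv : √5 * (1 / √5) = 1 := mul_one_div_cancel (by positivity)
    have hs0 : (0 : ℝ) ≤ s := s.2
    -- as `0 ≤ s`, the number `n` cannot be small
    have hn4 : (4 : ℝ) ≤ n := by
      have : 2 / (n : ℝ) ≤ 1 / 2 := by linarith
      rw [div_le_iff₀ hn'] at this
      linarith
    have hn2 : 2 ≤ n := by
      have : (2 : ℝ) ≤ n := by linarith
      exact_mod_cast this
    refine admissiblyRealized_of_le hn2 hr0 ?_ e s ?_
    · rw [le_div_iff₀ hn'] at hr
      linarith
    · have hx : 0 < 1 / (n : ℝ) := by positivity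
      have e2 : 2 / (n : ℝ) = 2 * (1 / n) := by ring
      have e6 : 6 / (n : ℝ) = 6 * (1 / n) := by ring
      rw [e2] at hs
      rw [e6]
      set x := 1 / (n : ℝ)
      set y := 1 / √5
      calc (√5 + 6 * x) * s ≤ (√5 + 6 * x) * (y - 2 * x) := by gcongr
        _ = 1 + 6 * x * y - 2 * x * √5 - 12 * x ^ 2 := by linear_combination hinv
        _ ≤ 1 := by nlinarith
  refine ⟨2, 1 / 100, by norm_num, by norm_num, by norm_num, fun n hn r hr0 hr => ⟨?_, ?_⟩⟩
  · rintro v ⟨s, e, hs, rfl⟩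
    exact ⟨s, e, key n hn r hr0 hr e s hs, rfl⟩
  · exact key n hn r hr0 hr
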